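/- **Conventions.** Circuits consist of C-NOTs and arbitrary single-qubit gates (a global phase is free); only C-NOTs are counted. An isometry $W$ from $m$ to $n$ qubits is a complex $2^n\times 2^m$ matrix with $W^\dagger W=I$, rows and columns being indexed from $0$ by the computational basis. A circuit on $n$ data qubits, $c$ clean and $d$ dirty ancillas implements $W$ if it maps $|j\rangle\otimes|0\rangle_c\otimes|b\rangle_d$ to $W|j\rangle\otimes|0\rangle_c\otimes|b\rangle_d$ for all $0\le j<2^m$ and all basis states $b$ of the $d$ dirty ancillas (on the left $|j\rangle$ is a basis state of $n$ qubits, i.e. the $n-m$ most significant data qubits start in $|0\rangle$). For fixed $(c,d)$ all the following numbers are the least numbers of C-NOTs that suffice for circuits with $c$ clean and $d$ dirty ancillas: $\mathcal N_{\Delta}(k)$ for any diagonal gate (diagonal entries of modulus one) on $k$ qubits; $\mathcal N^{\Delta}_{\Pi}(k)$ for any permutation gate on $k$ qubits up to a diagonal gate (i.e. for each permutation gate $\Pi$ it suffices to implement $\Delta\Pi$ for some diagonal gate $\Delta$); $\mathcal N_{\mathrm{SP}}(k)$ for state preparation of any $k$-qubit state $|v\rangle$ (some unitary mapping $|0\rangle$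 to $|v\rangle$); $\mathcal N_{H_0}(k)$ for $H_0=I-2|0\rangle\langle 0|$ on $k$ qubits; $\mathcal N_{\mathrm{Dec}_k}$ for $\mathrm{Dec}_k=\sum_{i=0}^{2^k-1}|i\rangle\langle i+1 \bmod 2^k|$; $\mathcal N_{\mathrm{iso}}(W)$ for the isometry $W$. The envelope $\operatorname{env}_W:\{0,\dots,2^m-1\}\to\{0,\dots,2^n-1\}$ is the pointwise smallest non-decreasing function such that $\langle i|W|j\rangle=0$ whenever $i>\operatorname{env}_W(j)$, and $\operatorname{ed}(W)=\sum_{j=0}^{2^m-1}(\operatorname{env}_W(j)-j)$. **Statement.** Let $W$ be an isometry from $m$ to $n$ qubits, let $\rho$ be a permutation of its rows and $\sigma$ a permutation of its columns, with permutation matrices $\Pi_\rho$ and $\Pi_\sigma$. (1) For all numbers $c,d\ge 0$ of clean and dirty ancillas, $$\mathcal N_{\mathrm{iso}}(W)\le \mathcal N^{\Delta}_{\Pi}(n)+\sum_{i=0}^{2^m-1}\mathcal N_{\mathrm{col}}(s(i))+\mathcal N^{\Delta}_{\Pi}(m)+\mathcal N_{\Delta}(m),$$ where $s(i)=\lceil\log_2(1+\operatorname{env}_{\Pi_\rho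 W\Pi_\sigma}(i)-i)\rceil$ and $\mathcal N_{\mathrm{col}}(s)=2\,\mathcal N_{\mathrm{SP}}(s)+\mathcal N_{H_0}(n)+\mathcal N_{\mathrm{Dec}_n}$. (2) With one dirty ancilla (and no clean one), $W$ can be implemented with at most $$4\operatorname{ed}(\Pi_\rho W\Pi_\sigma)+K\,n2^n$$ C-NOTs, where $K$ is an absolute constant (independent of $n,m,W,\rho,\sigma$). -/

import Mathlib

open scoped BigOperators

noncomputable section

namespace SparseIso

/-! Circuits on a finite set `ι` of qubits; the computational basis states are the functions
`ι → Fin 2`. -/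

/-- Elementary gates: arbitrary single-qubit unitaries, controlled-nots, and a global phase
(a "gate on zero qubits"; as soon as there is a qubit, it is also a single-qubit gate). -/
inductive Gate (ι : Type) : Type
  | single (q : ι) (U : Matrix.unitaryGroup (Fin 2) ℂ) : Gate ι
  | cnot (control target : ι) (h : control ≠ target) : Gate ι
  | phase (z : Circle) : Gate ι

/-- The unitary matrix of a gate on the whole register. -/
def Gate.mat {ι : Type} [Fintype ι] [DecidableEq ι] :
    Gate ι → Matrix (ι → Fin 2) (ι → Fin 2) ℂ
  | .single q U => Matrix.of fun x y =>
      if ∀ k, k ≠ q → x k = y k then (U : Matrix (Fin 2) (Fin 2) ℂ) (x q) (y q) else 0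
  | .cnot a t _ => Matrix.of fun x y =>
      if x = Function.update y t (y t + y a) then 1 else 0
  | .phase z => (z : ℂ) • (1 : Matrix (ι → Fin 2) (ι → Fin 2) ℂ)

/-- Whether a gate is a controlled-not. -/
def Gate.isCnot {ι : Type} : Gate ι → Bool
  | .single _ _ => false
  | .cnot _ _ _ => true
  | .phase _ => false

/-- A circuit is a list of gates; the head of the list is applied first. -/
abbrev Circuit (ι : Type) : Type := List (Gate ι)

/-- The unitary matrix of a circuit. -/
def Circuit.mat {ι : Type} [Fintype ι] [DecidableEq ι] :
    Circuit ι → Matrix (ι → Fin 2) (ι → Fin 2) ℂ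
  | [] => 1
  | g :: C => Circuit.mat C * g.mat

/-- The number of controlled-nots in a circuit. -/
def Circuit.cnotCount {ι : Type} (C : Circuit ι) : ℕ := C.countP Gate.isCnot

/-- The bits of a basis index of `n` qubits; qubit `k` holds the bit of weight `2 ^ k`. -/
def bits (n : ℕ) : Fin (2 ^ n) ≃ (Fin n → Fin 2) := finFunctionFinEquiv.symm

/-- A register of `n` data qubits, `c` clean ancillas and `d` dirty ancillas. -/
abbrev Register (n c d : ℕ) : Type := Fin n ⊕ (Fin c ⊕ Fin d)

/-- `Implements c d C V`: the circuit `C` on `n` data qubits, `c` clean ancillas (starting in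
`|0⟩`) and `d` dirty ancillas (starting in an unknown state) implements the `2 ^ n × 2 ^ m` matrix
`V`, where the input consists of the `m` least significant data qubits and the other data qubits
start in `|0⟩` (so that the data register starts in the basis state of `n` qubits with the same
index `j`). For all `j` and `b`, `C` maps `|j⟩ ⊗ |0⟩ ⊗ |b⟩` to `V |j⟩ ⊗ |0⟩ ⊗ |b⟩`.
For `m = n` this says that `C` implements the gate `V` on `n` qubits. -/
def Implements {n m : ℕ} (c d : ℕ) (C : Circuit (Register n c d))
    (V : Matrix (Fin (2 ^ n)) (Fin (2 ^ m)) ℂ) : Prop :=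
  ∀ (j : Fin (2 ^ m)) (y : Fin (2 ^ n)), (y : ℕ) = (j : ℕ) →
    ∀ (x : Fin (2 ^ n)) (a : Fin c → Fin 2) (b' b : Fin d → Fin 2),
      C.mat (Sum.elim (bits n x) (Sum.elim a b'))
          (Sum.elim (bits n y) (Sum.elim (fun _ => 0) b)) =
        if a = (fun _ => 0) ∧ b' = b then V x j else 0

/-- The least number of controlled-nots in a circuit that implements `V` with `c` clean and `d`
dirty ancillas (`⊤` if there is no such circuit). -/
def cnotCost {n m : ℕ} (c d : ℕ) (V : Matrix (Fin (2 ^ n)) (Fin (2 ^ m)) ℂ) : ℕ∞ :=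
  ⨅ (C : Circuit (Register n c d)) (_ : Implements c d C V), (C.cnotCount : ℕ∞)

/-- `W` is an isometry from `m` to `n` qubits. -/
def IsIsometry {n m : ℕ} (W : Matrix (Fin (2 ^ n)) (Fin (2 ^ m)) ℂ) : Prop :=
  W.conjTranspose * W = 1

/-! The gates that the method uses, and their controlled-not counts. -/

/-- The diagonal gate on `n` qubits with the given phases. -/
def diagGate {n : ℕ} (z : Fin (2 ^ n) → Circle) : Matrix (Fin (2 ^ n)) (Fin (2 ^ n)) ℂ :=
  Matrix.diagonal fun i => (z i : ℂ)

/-- The standard Householder reflection `H_v = I - 2 |v⟩⟨v|`. -/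
def householder {n : ℕ} (v : Fin (2 ^ n) → ℂ) : Matrix (Fin (2 ^ n)) (Fin (2 ^ n)) ℂ :=
  1 - (2 : ℂ) • Matrix.vecMulVec v (star v)

/-- The state `|0⟩` of `n` qubits. -/
def ketZero (n : ℕ) : Fin (2 ^ n) → ℂ := Pi.single 0 1

/-- The decrement gate `∑ i, |i⟩⟨i + 1|`, with addition modulo `2 ^ n`. -/
def decGate (n : ℕ) : Matrix (Fin (2 ^ n)) (Fin (2 ^ n)) ℂ :=
  Matrix.of fun i j => if j = i + 1 then 1 else 0

/-- The number of controlled-nots required for any diagonal gate on `n` qubits. -/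
def costDiag (c d n : ℕ) : ℕ∞ :=
  ⨆ z : Fin (2 ^ n) → Circle, cnotCost c d (diagGate z)

/-- The number of controlled-nots required for any permutation gate on `n` qubits, up to a
diagonal gate. -/
def costPermUpToDiag (c d n : ℕ) : ℕ∞ :=
  ⨆ π : Equiv.Perm (Fin (2 ^ n)), ⨅ z : Fin (2 ^ n) → Circle,
    cnotCost c d (diagGate z * π.permMatrix ℂ)

/-- The number of controlled-nots required for the preparation of any state `v` of `n` qubits,
that is, for some unitary that maps `|0⟩` to `v`. -/
def costStatePrep (c d n : ℕ) : ℕ∞ :=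
  ⨆ (v : Fin (2 ^ n) → ℂ) (_ : ∑ i, ‖v i‖ ^ 2 = 1),
    ⨅ (U : Matrix.unitaryGroup (Fin (2 ^ n)) ℂ)
      (_ : (U : Matrix (Fin (2 ^ n)) (Fin (2 ^ n)) ℂ).mulVec (ketZero n) = v),
      cnotCost c d (U : Matrix (Fin (2 ^ n)) (Fin (2 ^ n)) ℂ)

/-- The number of controlled-nots required for the Householder reflection `H_0` on `n` qubits. -/
def costH0 (c d n : ℕ) : ℕ∞ := cnotCost c d (householder (ketZero n))

/-- The number of controlled-nots required for the decrement gate on `n` qubits. -/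
def costDec (c d n : ℕ) : ℕ∞ := cnotCost c d (decGate n)

/-- The count for the reduction of one column: two state preparations on `s` qubits, and an `H_0`
and a decrement gate on `n` qubits. -/
def costCol (c d n s : ℕ) : ℕ∞ := 2 * costStatePrep c d s + costH0 c d n + costDec c d n

/-! Envelopes. -/

/-- The envelope of `W`: the least row index such that column `j` and all previous columns vanish
below that row. By `isLeast_env` it is the pointwise least non-decreasing function such that
every column `j` vanishes below row `env W j`. -/
def env {n m : ℕ} (W : Matrix (Fin (2 ^ n)) (Fin (2 ^ m)) ℂ) (j : Fin (2 ^ m)) : ℕ :=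
  sInf {r : ℕ | ∀ k ≤ j, ∀ i : Fin (2 ^ n), r < (i : ℕ) → W i k = 0}

theorem env_spec {n m : ℕ} (W : Matrix (Fin (2 ^ n)) (Fin (2 ^ m)) ℂ) (j : Fin (2 ^ m)) :
    ∀ k ≤ j, ∀ i : Fin (2 ^ n), env W j < (i : ℕ) → W i k = 0 := by
  have h : {r : ℕ | ∀ k ≤ j, ∀ i : Fin (2 ^ n), r < (i : ℕ) → W i k = 0}.Nonempty :=
    ⟨2 ^ n, fun k _ i hi => absurd i.isLt (by omega)⟩
  exact Nat.sInf_mem h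

theorem isLeast_env {n m : ℕ} (W : Matrix (Fin (2 ^ n)) (Fin (2 ^ m)) ℂ) :
    IsLeast {e : Fin (2 ^ m) → ℕ | Monotone e ∧
      ∀ (j : Fin (2 ^ m)) (i : Fin (2 ^ n)), e j < (i : ℕ) → W i j = 0} (env W) := by
  refine ⟨⟨fun j j' h => ?_, fun j i hi => env_spec W j j le_rfl i hi⟩, fun e he j => ?_⟩
  · exact Nat.sInf_le fun k hk i hi => env_spec W j' k (hk.trans h) i hi
  · exact Nat.sInf_le fun k hk i hi => he.2 k i (lt_of_le_of_lt (he.1 hk) hi)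

/-- The number of entries between the envelope and the diagonal. -/
def ed {n m : ℕ} (W : Matrix (Fin (2 ^ n)) (Fin (2 ^ m)) ℂ) : ℤ :=
  ∑ j : Fin (2 ^ m), ((env W j : ℤ) - (j : ℤ))

/-- `s(j) = ⌈log₂ (1 + env W j - j)⌉`; for an isometry `j ≤ env W j`, because its columns
`0, …, j` are linearly independent and supported on the rows `0, …, env W j`. -/
def logHeight {n m : ℕ} (W : Matrix (Fin (2 ^ n)) (Fin (2 ^ m)) ℂ) (j : Fin (2 ^ m)) : ℕ :=
  Nat.clog 2 (1 + env W j - (j : ℕ))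

/-- The permuted matrix `Π_ρ W Π_σ`. -/
def permuted {n m : ℕ} (ρ : Equiv.Perm (Fin (2 ^ n))) (σ : Equiv.Perm (Fin (2 ^ m)))
    (W : Matrix (Fin (2 ^ n)) (Fin (2 ^ m)) ℂ) : Matrix (Fin (2 ^ n)) (Fin (2 ^ m)) ℂ :=
  ρ.permMatrix ℂ * W * σ.permMatrix ℂ

end SparseIso

end

/-! The isometry is reduced to the inclusion of `m` qubits in `n` qubits, times a diagonal gate, by
clearing its columns from left to right (`exists_reduction`). When column `i` is reached, the
earlier columns are unit multiples of basis states, so orthogonality kills its entries above the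
diagonal and only the rows from `i` to the envelope remain. A unitary acting on just these rows
moves the column to its diagonal entry. It leaves the earlier columns alone and, the envelope being
monotone, creates nothing below the envelope in later columns. In `cnotCost_le_of_reduction` the
reduction is inverted. The diagonal gate that comes with the row permutation does not change the
zero pattern, and the one that comes with the column permutation merges with the phases left by the
reduction, so one diagonal gate on `m` qubits pays for both.

For the first bound, every column is cleared by one Householder reflection. After `i` decrements its
vector lives on the `s(i)` least significant qubits, and the reflection is `H_0` conjugated by a
state preparation. Passing from one column to the next costs one decrement, and the total shift by
`2 ^ m` is undone by single-qubit flips.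

The second bound uses no decrements. The band of a column is cut once into two intervals, each
inside an aligned dyadic block of less than twice its length (`exists_dyadic_split`). A state in a
block of size `2 ^ a` is disentangled with at most `2 ^ a - 1` C-NOTs (`exists_circuit_unprepare`),
so two reflections cost about four C-NOTs per row of the band. Joining the two intervals and the
gates `H_0`, built with the dirty ancilla (`costH0_le`), add `O(n)` per column. Permutations and
diagonal gates are products of `O(2 ^ n)` two-level gates of cost `O(n)`. -/

noncomputable section

namespace SparseIso

open Matrix Function

set_option linter.unusedSectionVars false

/-! ### Gates and circuits as operators on amplitudes, inverses, relabelling of qubits. -/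

section Actions

variable {ι : Type} [Fintype ι] [DecidableEq ι]

theorem Gate.single_mulVec (q : ι) (U : Matrix.unitaryGroup (Fin 2) ℂ) (ψ : (ι → Fin 2) → ℂ)
    (x : ι → Fin 2) :
    ((Gate.single q U).mat *ᵥ ψ) x =
      ∑ b, (U : Matrix (Fin 2) (Fin 2) ℂ) (x q) b * ψ (update x q b) := by
  simp only [Gate.mat, mulVec, dotProduct, Matrix.of_apply, ite_mul, zero_mul]
  rw [← Finset.sum_filter]
  symm
  refine Finset.sum_bij' (fun b _ => update x q b) (fun y _ => y q) ?_ ?_ ?_ ?_ ?_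
  · intro b _
    simp only [Finset.mem_filter, Finset.mem_univ, true_and]
    intro k hk
    simp [hk]
  · simp
  · intro b _
    simp
  · intro y hy
    simp only [Finset.mem_filter, Finset.mem_univ, true_and] at hy
    funext k
    by_cases hk : k = q
    · subst hk; simp
    · simp [hk, hy k hk]
  · intro b _
    simp

theorem Gate.cnot_mulVec (a t : ι) (h : a ≠ t) (ψ : (ι → Fin 2) → ℂ) (x : ι → Fin 2) :
    ((Gate.cnot a t h).mat *ᵥ ψ) x = ψ (update x t (x t + x a)) := by
  simp only [Gate.mat, mulVec, dotProduct, Matrix.of_apply, ite_mul, zero_mul, one_mul]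
  rw [Finset.sum_eq_single (update x t (x t + x a))]
  · rw [if_pos]
    funext k
    by_cases hk : k = t
    · subst hk
      simp only [update_self, update_of_ne h]
      generalize x k = u
      generalize x a = v
      revert u v
      decide
    · simp [hk]
  · intro y _ hy
    rw [if_neg]
    rintro rfl
    apply hy
    funext k
    by_cases hk : k = t
    · subst hk
      simp only [update_self, update_of_ne h]
      generalize y k = u
      generalize y a = v
      revert u v
      decide
    · simp [hk]
  · simp

theorem Gate.phase_mulVec (z : Circle) (ψ : (ι → Fin 2) → ℂ) :
    (Gate.phase z : Gate ι).mat *ᵥ ψ = (z : ℂ) • ψ := by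
  simp [Gate.mat, smul_mulVec]

theorem Circuit.mat_nil : Circuit.mat ([] : Circuit ι) = 1 := rfl

theorem Circuit.mat_cons (g : Gate ι) (C : Circuit ι) :
    Circuit.mat (g :: C) = Circuit.mat C * g.mat := rfl

theorem Circuit.mat_append (C D : Circuit ι) :
    Circuit.mat (C ++ D) = Circuit.mat D * Circuit.mat C := by
  induction C with
  | nil => simp [Circuit.mat]
  | cons g C ih => simp [Circuit.mat, ih, Matrix.mul_assoc]

theorem Circuit.append_mulVec (C D : Circuit ι) (ψ : (ι → Fin 2) → ℂ) :
    Circuit.mat (C ++ D) *ᵥ ψ = Circuit.mat D *ᵥ (Circuit.mat C *ᵥ ψ) := by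
  rw [Circuit.mat_append, Matrix.mulVec_mulVec]

theorem Circuit.cons_mulVec (g : Gate ι) (C : Circuit ι) (ψ : (ι → Fin 2) → ℂ) :
    Circuit.mat (g :: C) *ᵥ ψ = Circuit.mat C *ᵥ (g.mat *ᵥ ψ) := by
  rw [Circuit.mat_cons, Matrix.mulVec_mulVec]

theorem Circuit.singleton_mulVec (g : Gate ι) (ψ : (ι → Fin 2) → ℂ) :
    Circuit.mat [g] *ᵥ ψ = g.mat *ᵥ ψ := by
  simp [Circuit.mat]

theorem Circuit.cnotCount_append (C D : Circuit ι) :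
    Circuit.cnotCount (C ++ D) = C.cnotCount + D.cnotCount := by
  simp [Circuit.cnotCount]

/-- The inverse of a gate. -/
def Gate.inv : Gate ι → Gate ι
  | .single q U => .single q U⁻¹
  | .cnot a t h => .cnot a t h
  | .phase z => .phase z⁻¹

theorem Gate.inv_mul (g : Gate ι) : g.inv.mat * g.mat = 1 := by
  apply Matrix.ext_of_mulVec_single
  intro y
  rw [← Matrix.mulVec_mulVec, Matrix.one_mulVec]
  funext x
  cases g with
  | single q U =>
    have hU : ((U⁻¹ : Matrix.unitaryGroup (Fin 2) ℂ) : Matrix (Fin 2) (Fin 2) ℂ) * U = 1 := by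
      have : (U⁻¹ * U : Matrix.unitaryGroup (Fin 2) ℂ) = 1 := inv_mul_cancel U
      exact congrArg Subtype.val this
    simp only [Gate.inv, Gate.single_mulVec, update_self, update_idem, Finset.mul_sum]
    rw [Finset.sum_comm]
    simp only [← mul_assoc, ← Finset.sum_mul]
    have : ∀ b, ∑ i, ((U⁻¹ : Matrix.unitaryGroup (Fin 2) ℂ) : Matrix (Fin 2) (Fin 2) ℂ) (x q) i *
        (U : Matrix (Fin 2) (Fin 2) ℂ) i b = if x q = b then 1 else 0 := by
      intro b
      rw [← Matrix.mul_apply, hU, Matrix.one_apply]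
    simp only [this, ite_mul, one_mul, zero_mul, Finset.sum_ite_eq, Finset.mem_univ, if_true,
      update_eq_self]
  | cnot a t h =>
    simp only [Gate.inv, Gate.cnot_mulVec, update_self, update_of_ne h, update_idem]
    congr 1
    have : x t + x a + x a = x t := by
      generalize x t = u
      generalize x a = v
      revert u v
      decide
    rw [this, update_eq_self]
  | phase z =>
    simp only [Gate.inv, Gate.phase_mulVec, smul_smul, ← Circle.coe_mul, inv_mul_cancel,
      Circle.coe_one, one_smul]

theorem Gate.isCnot_inv (g : Gate ι) : g.inv.isCnot = g.isCnot := by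
  cases g <;> rfl

/-- The inverse of a circuit. -/
def Circuit.inv (C : Circuit ι) : Circuit ι := (C.map Gate.inv).reverse

theorem Circuit.inv_mul (C : Circuit ι) : C.inv.mat * C.mat = 1 := by
  induction C with
  | nil => simp [Circuit.inv, Circuit.mat]
  | cons g C ih =>
    have : Circuit.inv (g :: C) = Circuit.inv C ++ [g.inv] := by simp [Circuit.inv]
    rw [this, Circuit.mat_append, Circuit.mat_cons, Circuit.mat_cons, Circuit.mat_nil, one_mul,
      Matrix.mul_assoc, ← Matrix.mul_assoc (Circuit.inv C).mat, ih, one_mul, Gate.inv_mul]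

theorem Circuit.cnotCount_inv (C : Circuit ι) : C.inv.cnotCount = C.cnotCount := by
  simp only [Circuit.cnotCount, Circuit.inv, List.countP_reverse, List.countP_map]
  congr 1
  funext g
  exact Gate.isCnot_inv g

theorem Gate.inv_mat (g : Gate ι) : g.inv.mat = g.matᴴ := by
  ext x y
  cases g with
  | single q U =>
    have h : (∀ k, k ≠ q → y k = x k) ↔ ∀ k, k ≠ q → x k = y k :=
      forall₂_congr fun _ _ => eq_comm
    simp only [Gate.inv, Gate.mat, Matrix.of_apply, Matrix.conjTranspose_apply, h]
    split_ifs
    · rfl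
    · simp
  | cnot a t hat =>
    have key : ∀ x y : ι → Fin 2, x = update y t (y t + y a) → y = update x t (x t + x a) := by
      rintro x y rfl
      simp only [update_self, update_of_ne hat, update_idem]
      have : y t + y a + y a = y t := by
        generalize y t = u
        generalize y a = v
        revert u v
        decide
      rw [this, update_eq_self]
    have h : y = update x t (x t + x a) ↔ x = update y t (y t + y a) := ⟨key y x, key x y⟩
    simp only [Gate.inv, Gate.mat, Matrix.of_apply, Matrix.conjTranspose_apply, h]
    split_ifs <;> simp
  | phase z =>
    simp only [Gate.inv, Gate.mat, Matrix.conjTranspose_smul, Matrix.conjTranspose_one,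
      Circle.coe_inv_eq_conj]
    rfl

theorem Circuit.conjTranspose_mul_mat (C : Circuit ι) : C.matᴴ * C.mat = 1 := by
  induction C with
  | nil => simp [Circuit.mat]
  | cons g C ih =>
    rw [Circuit.mat_cons, Matrix.conjTranspose_mul, Matrix.mul_assoc, ← Matrix.mul_assoc _ _ g.mat,
      ih, Matrix.one_mul, ← Gate.inv_mat, Gate.inv_mul]

variable {κ : Type} [Fintype κ] [DecidableEq κ]

/-- The gate on a larger register. -/
def Gate.map (f : κ → ι) (hf : Injective f) : Gate κ → Gate ι
  | .single q U => .single (f q) U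
  | .cnot a t h => .cnot (f a) (f t) (hf.ne h)
  | .phase z => .phase z

/-- The circuit on a larger register. -/
def Circuit.map (f : κ → ι) (hf : Injective f) (C : Circuit κ) : Circuit ι :=
  List.map (Gate.map f hf) C

theorem Circuit.cnotCount_map (f : κ → ι) (hf : Injective f) (C : Circuit κ) :
    (C.map f hf).cnotCount = C.cnotCount := by
  simp only [Circuit.cnotCount, Circuit.map, List.countP_map]
  congr 1
  funext g
  cases g <;> rfl

theorem extend_update {f : κ → ι} (hf : Injective f) (u : κ → Fin 2) (x : ι → Fin 2) (k : κ)
    (b : Fin 2) : extend f (update u k b) x = update (extend f u x) (f k) b := by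
  funext i
  by_cases hi : ∃ j, f j = i
  · obtain ⟨j, rfl⟩ := hi
    rw [hf.extend_apply]
    by_cases hj : j = k
    · subst hj; simp
    · rw [update_of_ne hj, update_of_ne (hf.ne hj), hf.extend_apply]
  · rw [extend_apply' _ _ _ hi, update_of_ne, extend_apply' _ _ _ hi]
    rintro rfl
    exact hi ⟨k, rfl⟩

theorem Gate.map_mulVec {f : κ → ι} (hf : Injective f) (g : Gate κ) (ψ : (ι → Fin 2) → ℂ)
    (x : ι → Fin 2) (u : κ → Fin 2) :
    ((g.map f hf).mat *ᵥ ψ) (extend f u x) = (g.mat *ᵥ fun u => ψ (extend f u x)) u := by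
  cases g with
  | single q U => simp [Gate.map, Gate.single_mulVec, extend_update hf, hf.extend_apply]
  | cnot a t h => simp [Gate.map, Gate.cnot_mulVec, extend_update hf, hf.extend_apply]
  | phase z => simp [Gate.map, Gate.phase_mulVec]

/-- A mapped circuit acts on every slice of the state as the given circuit. -/
theorem Circuit.map_mulVec {f : κ → ι} (hf : Injective f) (C : Circuit κ)
    (ψ : (ι → Fin 2) → ℂ) (x : ι → Fin 2) (u : κ → Fin 2) :
    ((C.map f hf).mat *ᵥ ψ) (extend f u x) = (C.mat *ᵥ fun u => ψ (extend f u x)) u := by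
  induction C generalizing ψ u with
  | nil => simp [Circuit.map, Circuit.mat]
  | cons g C ih =>
    have : Circuit.map f hf (g :: C) = g.map f hf :: Circuit.map f hf C := rfl
    rw [this, Circuit.cons_mulVec, Circuit.cons_mulVec, ih]
    congr 2
    funext v
    exact Gate.map_mulVec hf g ψ x v

theorem extend_comp_self {f : κ → ι} (hf : Injective f) (x : ι → Fin 2) :
    extend f (fun k => x (f k)) x = x := by
  funext i
  by_cases hi : ∃ j, f j = i
  · obtain ⟨j, rfl⟩ := hi
    rw [hf.extend_apply]
  · rw [extend_apply' _ _ _ hi]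

theorem Circuit.map_mulVec' {f : κ → ι} (hf : Injective f) (C : Circuit κ)
    (ψ : (ι → Fin 2) → ℂ) (x : ι → Fin 2) :
    ((C.map f hf).mat *ᵥ ψ) x = (C.mat *ᵥ fun u => ψ (extend f u x)) fun k => x (f k) := by
  rw [← Circuit.map_mulVec hf C ψ x, extend_comp_self hf]

end Actions

/-! ### Registers with ancillas, and the calculus of C-NOT costs. -/

section Registers

variable {n m k c d : ℕ}

/-- The inclusion of `m` qubits in `n` qubits, the other qubits being in the state `|0⟩`. -/
def incl (n m : ℕ) : Matrix (Fin (2 ^ n)) (Fin (2 ^ m)) ℂ :=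
  Matrix.of fun x j => if (x : ℕ) = j then 1 else 0

theorem incl_mulVec (φ : Fin (2 ^ m) → ℂ) (x : Fin (2 ^ n)) :
    (incl n m *ᵥ φ) x = if h : (x : ℕ) < 2 ^ m then φ ⟨x, h⟩ else 0 := by
  simp only [incl, mulVec, dotProduct, Matrix.of_apply, ite_mul, one_mul, zero_mul]
  split_ifs with h
  · rw [Finset.sum_eq_single ⟨x, h⟩]
    · simp
    · intro j _ hj
      rw [if_neg]
      intro hx
      exact hj (Fin.ext hx.symm)
    · simp
  · apply Finset.sum_eq_zero
    intro j _
    rw [if_neg]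
    intro hx
    exact h (hx ▸ j.isLt)

theorem incl_self : incl n n = 1 := by
  ext x j
  simp [incl, Matrix.one_apply, Fin.ext_iff]

theorem incl_mul_apply (V : Matrix (Fin (2 ^ m)) (Fin (2 ^ k)) ℂ)
    (x : Fin (2 ^ n)) (j : Fin (2 ^ k)) :
    (incl n m * V) x j = if h : (x : ℕ) < 2 ^ m then V ⟨x, h⟩ j else 0 :=
  incl_mulVec (fun i => V i j) x

theorem mul_incl_apply (hmn : m ≤ n) {α : Type*} (A : Matrix α (Fin (2 ^ n)) ℂ) (x : α)
    (j : Fin (2 ^ m)) :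
    (A * incl n m) x j = A x ⟨j, j.isLt.trans_le (Nat.pow_le_pow_right two_pos hmn)⟩ := by
  simp only [incl, Matrix.mul_apply, Matrix.of_apply, mul_ite, mul_one, mul_zero]
  rw [Finset.sum_eq_single ⟨j, j.isLt.trans_le (Nat.pow_le_pow_right two_pos hmn)⟩]
  · simp
  · intro y _ hy
    rw [if_neg]
    intro h
    exact hy (Fin.ext h)
  · simp

/-- The embedding of the data states in the register, with the clean ancillas in `|0⟩` and the
dirty ancillas in `|b⟩`. -/
def dataEmb (n c : ℕ) {d : ℕ} (b : Fin d → Fin 2) :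
    Matrix (Register n c d → Fin 2) (Fin (2 ^ n)) ℂ :=
  Matrix.of fun X x => if X = Sum.elim (bits n x) (Sum.elim (fun _ => 0) b) then 1 else 0

theorem dataEmb_mulVec (b : Fin d → Fin 2) (φ : Fin (2 ^ n) → ℂ) (X : Register n c d → Fin 2) :
    (dataEmb n c b *ᵥ φ) X =
      if (∀ i, X (Sum.inr (Sum.inl i)) = 0) ∧ ∀ i, X (Sum.inr (Sum.inr i)) = b i then
        φ ((bits n).symm fun k => X (Sum.inl k)) else 0 := by
  simp only [dataEmb, mulVec, dotProduct, Matrix.of_apply, ite_mul, one_mul, zero_mul]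
  have key : ∀ x, X = Sum.elim (bits n x) (Sum.elim (fun _ => 0) b) ↔
      ((∀ i, X (Sum.inr (Sum.inl i)) = 0) ∧ ∀ i, X (Sum.inr (Sum.inr i)) = b i) ∧
        (bits n).symm (fun k => X (Sum.inl k)) = x := by
    intro x
    rw [Equiv.symm_apply_eq]
    constructor
    · rintro rfl
      simp
    · rintro ⟨⟨h1, h2⟩, h3⟩
      funext i
      rcases i with i | i | i
      · exact congrFun h3 i
      · exact h1 i
      · exact h2 i
  simp only [key]
  split_ifs with h
  · simp [h]
  · simp [h]

theorem mul_dataEmb_apply {α : Type*} (A : Matrix α (Register n c d → Fin 2) ℂ)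
    (b : Fin d → Fin 2) (X : α) (x : Fin (2 ^ n)) :
    (A * dataEmb n c b) X x = A X (Sum.elim (bits n x) (Sum.elim (fun _ => 0) b)) := by
  simp [dataEmb, Matrix.mul_apply]

/-- Entrywise implementation becomes an intertwining relation with the embedding of the data states,
so that composing circuits is just associativity of matrix products. -/
theorem implements_iff (hmn : m ≤ n) (C : Circuit (Register n c d))
    (V : Matrix (Fin (2 ^ n)) (Fin (2 ^ m)) ℂ) :
    Implements c d C V ↔
      ∀ b : Fin d → Fin 2, C.mat * (dataEmb n c b * incl n m) = dataEmb n c b * V := by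
  have hR : ∀ (b : Fin d → Fin 2) (x : Fin (2 ^ n)) (a : Fin c → Fin 2) (b' : Fin d → Fin 2)
      (j : Fin (2 ^ m)), (dataEmb n c b * V) (Sum.elim (bits n x) (Sum.elim a b')) j =
        if a = (fun _ => 0) ∧ b' = b then V x j else 0 := by
    intro b x a b' j
    have := dataEmb_mulVec (c := c) b (fun x => V x j) (Sum.elim (bits n x) (Sum.elim a b'))
    refine Eq.trans this ?_
    simp [funext_iff]
  constructor
  · intro h b
    ext X j
    rw [← Matrix.mul_assoc, mul_incl_apply hmn, mul_dataEmb_apply]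
    obtain ⟨x, a, b', rfl⟩ : ∃ x a b', X = Sum.elim (bits n x) (Sum.elim a b') := by
      refine ⟨(bits n).symm fun k => X (Sum.inl k), fun i => X (Sum.inr (Sum.inl i)),
        fun i => X (Sum.inr (Sum.inr i)), ?_⟩
      funext i
      rcases i with i | i | i <;> simp
    rw [h j _ rfl, hR]
  · intro h j y hy x a b' b
    have := congrFun (congrFun (h b) (Sum.elim (bits n x) (Sum.elim a b'))) j
    rw [← Matrix.mul_assoc, mul_incl_apply hmn, mul_dataEmb_apply, hR] at this
    rw [← this]
    congr
    exact Fin.ext hy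

theorem implements_square_iff (C : Circuit (Register n c d))
    (V : Matrix (Fin (2 ^ n)) (Fin (2 ^ n)) ℂ) :
    Implements c d C V ↔ ∀ b : Fin d → Fin 2, C.mat * dataEmb n c b = dataEmb n c b * V := by
  rw [implements_iff le_rfl]
  simp [incl_self]

theorem cnotCost_le {C : Circuit (Register n c d)} {V : Matrix (Fin (2 ^ n)) (Fin (2 ^ m)) ℂ}
    (h : Implements c d C V) : cnotCost c d V ≤ C.cnotCount :=
  iInf₂_le C h

theorem exists_circuit_of_cnotCost_ne_top {V : Matrix (Fin (2 ^ n)) (Fin (2 ^ m)) ℂ}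
    (h : cnotCost c d V ≠ ⊤) :
    ∃ C : Circuit (Register n c d), Implements c d C V ∧ (C.cnotCount : ℕ∞) = cnotCost c d V := by
  obtain ⟨N, hN⟩ := ENat.ne_top_iff_exists.mp h
  have hlt : cnotCost c d V < (N + 1 : ℕ) := by
    rw [← hN]
    exact_mod_cast Nat.lt_succ_self N
  simp only [cnotCost, iInf_lt_iff] at hlt
  obtain ⟨C, hC, hlt⟩ := hlt
  refine ⟨C, hC, le_antisymm ?_ (cnotCost_le hC)⟩
  rw [← hN]
  have : C.cnotCount < N + 1 := by exact_mod_cast hlt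
  exact_mod_cast Nat.le_of_lt_succ this

/-- The first circuit returns every ancilla to its initial state, so the second can reuse the same
ancillas. -/
theorem cnotCost_mul_le (hmn : m ≤ n) (U : Matrix (Fin (2 ^ n)) (Fin (2 ^ n)) ℂ)
    (V : Matrix (Fin (2 ^ n)) (Fin (2 ^ m)) ℂ) :
    cnotCost c d (U * V) ≤ cnotCost c d U + cnotCost c d V := by
  by_cases hU : cnotCost c d U = ⊤
  · simp [hU]
  by_cases hV : cnotCost c d V = ⊤
  · simp [hV]
  obtain ⟨C, hC, hCc⟩ := exists_circuit_of_cnotCost_ne_top hU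
  obtain ⟨D, hD, hDc⟩ := exists_circuit_of_cnotCost_ne_top hV
  rw [implements_square_iff] at hC
  rw [implements_iff hmn] at hD
  have : Implements c d (D ++ C) (U * V) := by
    rw [implements_iff hmn]
    intro b
    rw [Circuit.mat_append, Matrix.mul_assoc, hD, ← Matrix.mul_assoc, hC, Matrix.mul_assoc]
  refine (cnotCost_le this).trans ?_
  rw [Circuit.cnotCount_append, ← hCc, ← hDc, add_comm]
  push_cast
  exact le_rfl

/-- The inverse circuit does it. Unitarity of `U` is needed because the circuit agrees with `U` only
on the embedded data states. -/
theorem cnotCost_conjTranspose_le {U : Matrix (Fin (2 ^ n)) (Fin (2 ^ n)) ℂ} (hU : Uᴴ * U = 1) :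
    cnotCost c d Uᴴ ≤ cnotCost c d U := by
  by_cases h : cnotCost c d U = ⊤
  · simp [h]
  obtain ⟨C, hC, hCc⟩ := exists_circuit_of_cnotCost_ne_top h
  rw [implements_square_iff] at hC
  have hU' : U * Uᴴ = 1 := mul_eq_one_comm.mp hU
  have : Implements c d C.inv Uᴴ := by
    rw [implements_square_iff]
    intro b
    calc C.inv.mat * dataEmb n c b = C.inv.mat * (dataEmb n c b * U) * Uᴴ := by
          rw [Matrix.mul_assoc, Matrix.mul_assoc, hU', Matrix.mul_one]
      _ = dataEmb n c b * Uᴴ := by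
          rw [← hC, ← Matrix.mul_assoc, Circuit.inv_mul, Matrix.one_mul]
  refine (cnotCost_le this).trans ?_
  rw [Circuit.cnotCount_inv, hCc]

theorem cnotCost_incl (hmn : m ≤ n) : cnotCost c d (incl n m) = 0 := by
  have : Implements c d ([] : Circuit (Register n c d)) (incl n m) := by
    rw [implements_iff hmn]
    simp [Circuit.mat]
  simpa [Circuit.cnotCount] using cnotCost_le this

theorem cnotCost_one : cnotCost c d (1 : Matrix (Fin (2 ^ n)) (Fin (2 ^ n)) ℂ) = 0 := by
  rw [← incl_self]
  exact cnotCost_incl le_rfl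

/-! Gates on the least significant qubits. -/

/-- The value of the `k` least significant of `n` qubits. -/
def lowPart (hk : k ≤ n) (x : Fin (2 ^ n)) : Fin (2 ^ k) :=
  (bits k).symm fun i => bits n x (Fin.castLE hk i)

/-- Replace the `k` least significant of `n` qubits. -/
def setLow (hk : k ≤ n) (r : Fin (2 ^ k)) (x : Fin (2 ^ n)) : Fin (2 ^ n) :=
  (bits n).symm (extend (Fin.castLE hk) (bits k r) (bits n x))

theorem lowPart_setLow (hk : k ≤ n) (r : Fin (2 ^ k)) (x : Fin (2 ^ n)) :
    lowPart hk (setLow hk r x) = r := by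
  simp [lowPart, setLow, (Fin.castLE_injective hk).extend_apply]

theorem setLow_lowPart (hk : k ≤ n) (x : Fin (2 ^ n)) : setLow hk (lowPart hk x) x = x := by
  simp only [lowPart, setLow, Equiv.apply_symm_apply]
  rw [extend_comp_self (Fin.castLE_injective hk), Equiv.symm_apply_apply]

theorem setLow_setLow (hk : k ≤ n) (r s : Fin (2 ^ k)) (x : Fin (2 ^ n)) :
    setLow hk r (setLow hk s x) = setLow hk r x := by
  simp only [setLow, Equiv.apply_symm_apply]
  congr 1
  funext i
  by_cases hi : ∃ j, Fin.castLE hk j = i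
  · obtain ⟨j, rfl⟩ := hi
    simp [(Fin.castLE_injective hk).extend_apply]
  · simp [extend_apply' _ _ _ hi]

/-- The gate `1 ⊗ V` on `n` qubits, where `V` acts on the `k` least significant qubits. -/
def lowLift (hk : k ≤ n) (V : Matrix (Fin (2 ^ k)) (Fin (2 ^ k)) ℂ) :
    Matrix (Fin (2 ^ n)) (Fin (2 ^ n)) ℂ :=
  Matrix.of fun x y => if y = setLow hk (lowPart hk y) x then V (lowPart hk x) (lowPart hk y) else 0

theorem lowLift_mulVec (hk : k ≤ n) (V : Matrix (Fin (2 ^ k)) (Fin (2 ^ k)) ℂ)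
    (φ : Fin (2 ^ n) → ℂ) (x : Fin (2 ^ n)) :
    (lowLift hk V *ᵥ φ) x = ∑ r, V (lowPart hk x) r * φ (setLow hk r x) := by
  simp only [lowLift, mulVec, dotProduct, Matrix.of_apply, ite_mul, zero_mul]
  rw [← Finset.sum_filter]
  symm
  refine Finset.sum_bij' (fun r _ => setLow hk r x) (fun y _ => lowPart hk y) ?_ ?_ ?_ ?_ ?_
  · simp [lowPart_setLow]
  · simp
  · simp [lowPart_setLow]
  · intro y hy
    exact (Finset.mem_filter.mp hy).2.symm
  · simp [lowPart_setLow]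

theorem lowLift_mul (hk : k ≤ n) (U V : Matrix (Fin (2 ^ k)) (Fin (2 ^ k)) ℂ) :
    lowLift hk U * lowLift hk V = lowLift hk (U * V) := by
  apply Matrix.ext_of_mulVec_single
  intro y
  rw [← Matrix.mulVec_mulVec]
  funext x
  simp only [lowLift_mulVec, lowPart_setLow, setLow_setLow, Finset.mul_sum, Matrix.mul_apply,
    Finset.sum_mul, mul_assoc]
  rw [Finset.sum_comm]

theorem lowLift_one (hk : k ≤ n) : lowLift hk (1 : Matrix (Fin (2 ^ k)) (Fin (2 ^ k)) ℂ) = 1 := by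
  apply Matrix.ext_of_mulVec_single
  intro y
  funext x
  simp only [lowLift_mulVec, Matrix.one_apply, ite_mul, one_mul, zero_mul, Finset.sum_ite_eq,
    Finset.mem_univ, if_true, setLow_lowPart, Matrix.one_mulVec]

theorem lowLift_conjTranspose (hk : k ≤ n) (V : Matrix (Fin (2 ^ k)) (Fin (2 ^ k)) ℂ) :
    (lowLift hk V)ᴴ = lowLift hk Vᴴ := by
  ext x y
  have : x = setLow hk (lowPart hk x) y ↔ y = setLow hk (lowPart hk y) x := by
    constructor
    · intro h
      rw [h, setLow_setLow, setLow_lowPart]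
    · intro h
      rw [h, setLow_setLow, setLow_lowPart]
  simp only [lowLift, conjTranspose_apply, Matrix.of_apply, this]
  split_ifs <;> simp

theorem lowLift_isometry (hk : k ≤ n) {V : Matrix (Fin (2 ^ k)) (Fin (2 ^ k)) ℂ}
    (hV : Vᴴ * V = 1) : (lowLift hk V)ᴴ * lowLift hk V = 1 := by
  rw [lowLift_conjTranspose, lowLift_mul, hV, lowLift_one]

/-- The other data qubits are spectators: the relabelled circuit acts on each slice where they are
fixed exactly as the original one does. -/
theorem cnotCost_lowLift_le (hk : k ≤ n) (V : Matrix (Fin (2 ^ k)) (Fin (2 ^ k)) ℂ) :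
    cnotCost c d (lowLift hk V) ≤ cnotCost c d V := by
  by_cases h : cnotCost c d V = ⊤
  · simp [h]
  obtain ⟨C, hC, hCc⟩ := exists_circuit_of_cnotCost_ne_top h
  rw [implements_square_iff] at hC
  let f : Register k c d → Register n c d := Sum.map (Fin.castLE hk) id
  have hf : Injective f := (Fin.castLE_injective hk).sumMap injective_id
  have : Implements c d (C.map f hf) (lowLift hk V) := by
    rw [implements_square_iff]
    intro b
    apply Matrix.ext_of_mulVec_single
    intro y
    rw [← Matrix.mulVec_mulVec, ← Matrix.mulVec_mulVec]
    generalize (Pi.single y 1 : Fin (2 ^ n) → ℂ) = φ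
    funext X
    rw [Circuit.map_mulVec']
    have hslice : (fun u => (dataEmb n c b *ᵥ φ) (extend f u X)) =
        dataEmb k c b *ᵥ fun r =>
          φ (setLow hk r ((bits n).symm fun i => X (Sum.inl i))) := by
      funext u
      rw [dataEmb_mulVec, dataEmb_mulVec]
      have h1 : ∀ i : Fin c ⊕ Fin d, extend f u X (Sum.inr i) = u (Sum.inr i) := fun i =>
        hf.extend_apply u X (Sum.inr i)
      have h2 : (fun i => extend f u X (Sum.inl i)) =
          extend (Fin.castLE hk) (fun i => u (Sum.inl i)) fun i => X (Sum.inl i) := by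
        funext i
        by_cases hi : ∃ j, Fin.castLE hk j = i
        · obtain ⟨j, rfl⟩ := hi
          rw [(Fin.castLE_injective hk).extend_apply]
          exact hf.extend_apply u X (Sum.inl j)
        · rw [extend_apply' _ _ _ hi, extend_apply']
          rintro ⟨j | j, hj⟩
          · exact hi ⟨j, Sum.inl_injective hj⟩
          · simp [f] at hj
      simp only [h1, h2, setLow, Equiv.apply_symm_apply]
    rw [hslice, Matrix.mulVec_mulVec, hC, ← Matrix.mulVec_mulVec, dataEmb_mulVec, dataEmb_mulVec,
      lowLift_mulVec]
    simp only [f, lowPart, Sum.map_inl, Sum.map_inr, id, Equiv.apply_symm_apply]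
    rfl
  refine (cnotCost_le this).trans ?_
  rw [Circuit.cnotCount_map, hCc]

theorem bits_val (n : ℕ) (x : Fin (2 ^ n)) (i : Fin n) :
    (bits n x i : ℕ) = x / 2 ^ (i : ℕ) % 2 := by
  simp [bits, finFunctionFinEquiv]

theorem lt_two_pow_iff_bits (x : Fin (2 ^ n)) :
    (x : ℕ) < 2 ^ k ↔ ∀ i : Fin n, k ≤ i → bits n x i = 0 := by
  constructor
  · intro h i hi
    apply Fin.ext
    rw [bits_val, Nat.div_eq_of_lt (h.trans_le (Nat.pow_le_pow_right two_pos hi))]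
    rfl
  · intro h
    by_contra hx
    push Not at hx
    obtain ⟨i, hki, hi⟩ := Nat.exists_ge_and_testBit_of_ge_two_pow hx
    have hin : i < n := by
      by_contra hin
      push Not at hin
      rw [Nat.testBit_lt_two_pow (x.isLt.trans_le (Nat.pow_le_pow_right two_pos hin))] at hi
      exact Bool.noConfusion hi
    have := congrArg Fin.val (h ⟨i, hin⟩ hki)
    rw [bits_val] at this
    rw [Nat.testBit_eq_decide_div_mod_eq] at hi
    simp at this hi
    omega

theorem bits_castLE (hk : k ≤ n) (j : Fin (2 ^ k)) (i : Fin k) :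
    bits n (Fin.castLE (Nat.pow_le_pow_right two_pos hk) j) (Fin.castLE hk i) = bits k j i := by
  apply Fin.ext
  simp [bits_val]

theorem setLow_of_lt (hk : k ≤ n) (r : Fin (2 ^ k)) {x : Fin (2 ^ n)} (hx : (x : ℕ) < 2 ^ k) :
    setLow hk r x = Fin.castLE (Nat.pow_le_pow_right two_pos hk) r := by
  rw [setLow, Equiv.symm_apply_eq]
  funext i
  by_cases hi : ∃ j, Fin.castLE hk j = i
  · obtain ⟨j, rfl⟩ := hi
    rw [(Fin.castLE_injective hk).extend_apply, bits_castLE]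
  · have hki : k ≤ i := by
      by_contra h
      push Not at h
      exact hi ⟨⟨i, h⟩, rfl⟩
    rw [extend_apply' _ _ _ hi, (lt_two_pow_iff_bits x).mp hx i hki,
      (lt_two_pow_iff_bits _).mp _ i hki]
    exact r.isLt

theorem setLow_lt_iff (hk : k ≤ n) (r : Fin (2 ^ k)) (x : Fin (2 ^ n)) :
    (setLow hk r x : ℕ) < 2 ^ k ↔ (x : ℕ) < 2 ^ k := by
  have key : ∀ (r : Fin (2 ^ k)) (x : Fin (2 ^ n)), (x : ℕ) < 2 ^ k →
      (setLow hk r x : ℕ) < 2 ^ k := by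
    intro r x hx
    rw [setLow_of_lt hk r hx]
    exact r.isLt
  refine ⟨fun h => ?_, key r x⟩
  have := key (lowPart hk x) _ h
  rwa [setLow_setLow, setLow_lowPart] at this

theorem lowPart_of_lt (hk : k ≤ n) {x : Fin (2 ^ n)} (hx : (x : ℕ) < 2 ^ k) :
    lowPart hk x = ⟨x, hx⟩ := by
  have := setLow_of_lt hk (lowPart hk x) hx
  rw [setLow_lowPart] at this
  exact Fin.ext (congrArg Fin.val this).symm

theorem lowLift_mulVec_incl (hk : k ≤ n) (V : Matrix (Fin (2 ^ k)) (Fin (2 ^ k)) ℂ)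
    (φ : Fin (2 ^ k) → ℂ) :
    lowLift hk V *ᵥ (incl n k *ᵥ φ) = incl n k *ᵥ (V *ᵥ φ) := by
  funext x
  rw [lowLift_mulVec, incl_mulVec]
  split_ifs with h
  · rw [lowPart_of_lt hk h]
    simp only [setLow_of_lt hk _ h, incl_mulVec]
    simp [mulVec, dotProduct]
  · apply Finset.sum_eq_zero
    intro r _
    rw [incl_mulVec, dif_neg, mul_zero]
    rwa [setLow_lt_iff]

/-- This moves gates on the input qubits of an isometry to the output side of the inclusion, where
they are gates on the data register. -/
theorem lowLift_mul_incl (hk : k ≤ n) (V : Matrix (Fin (2 ^ k)) (Fin (2 ^ k)) ℂ) :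
    lowLift hk V * incl n k = incl n k * V := by
  apply Matrix.ext_of_mulVec_single
  intro y
  rw [← Matrix.mulVec_mulVec, ← Matrix.mulVec_mulVec, lowLift_mulVec_incl]

/-! Circuits on the data qubits only. -/

/-- The matrix of a circuit on the data qubits, with rows and columns indexed by numbers. -/
def Circuit.dataMat (C : Circuit (Fin n)) : Matrix (Fin (2 ^ n)) (Fin (2 ^ n)) ℂ :=
  C.mat.submatrix (bits n) (bits n)

theorem Circuit.dataMat_mulVec (C : Circuit (Fin n)) (φ : Fin (2 ^ n) → ℂ) (x : Fin (2 ^ n)) :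
    (C.dataMat *ᵥ φ) x = (C.mat *ᵥ fun u => φ ((bits n).symm u)) (bits n x) := by
  simp only [Circuit.dataMat, mulVec, dotProduct, Matrix.submatrix_apply]
  rw [← (bits n).sum_comp]
  simp

theorem cnotCost_dataMat_le (C : Circuit (Fin n)) : cnotCost c d C.dataMat ≤ C.cnotCount := by
  have hf : Injective (Sum.inl : Fin n → Register n c d) := Sum.inl_injective
  have : Implements c d (C.map _ hf) C.dataMat := by
    rw [implements_square_iff]
    intro b
    apply Matrix.ext_of_mulVec_single
    intro y
    rw [← Matrix.mulVec_mulVec, ← Matrix.mulVec_mulVec]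
    generalize (Pi.single y 1 : Fin (2 ^ n) → ℂ) = φ
    funext X
    rw [Circuit.map_mulVec', dataEmb_mulVec, Circuit.dataMat_mulVec]
    have hr : ∀ (u : Fin n → Fin 2) i, extend Sum.inl u X (Sum.inr i) = X (Sum.inr i) := by
      intro u i
      rw [extend_apply']
      rintro ⟨j, hj⟩
      cases hj
    simp only [dataEmb_mulVec, hr, hf.extend_apply, Equiv.apply_symm_apply]
    split_ifs with h
    · rfl
    · exact congrFun (Matrix.mulVec_zero C.mat) _
  refine (cnotCost_le this).trans ?_
  rw [Circuit.cnotCount_map]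

theorem Circuit.dataMat_isometry (C : Circuit (Fin n)) : C.dataMatᴴ * C.dataMat = 1 := by
  rw [Circuit.dataMat, Matrix.conjTranspose_submatrix, Matrix.submatrix_mul_equiv,
    Circuit.conjTranspose_mul_mat, Matrix.submatrix_one_equiv]

end Registers

/-! ### Reflections that align one vector with another. -/

section Reflections

variable {α : Type*} [Fintype α]

theorem star_dotProduct_self (w : α → ℂ) : star w ⬝ᵥ w = ((∑ i, ‖w i‖ ^ 2 : ℝ) : ℂ) := by
  simp only [dotProduct, Pi.star_apply, Complex.ofReal_sum]
  refine Finset.sum_congr rfl fun i _ => ?_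
  rw [RCLike.star_def, Complex.conj_mul']
  push_cast
  rfl

theorem sum_norm_sq_pos {w : α → ℂ} (hw : w ≠ 0) : 0 < ∑ i, ‖w i‖ ^ 2 := by
  obtain ⟨i, hi⟩ := Function.ne_iff.mp hw
  refine Finset.sum_pos' (fun _ _ => by positivity) ⟨i, Finset.mem_univ i, ?_⟩
  have : w i ≠ 0 := hi
  positivity

/-- A multiple of a nonzero vector by a real number is a unit vector. -/
theorem exists_normalize {w : α → ℂ} (hw : w ≠ 0) :
    ∃ s : ℝ, s ≠ 0 ∧ star w ⬝ᵥ w = (s : ℂ) ^ 2 ∧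
      star ((s : ℂ)⁻¹ • w) ⬝ᵥ ((s : ℂ)⁻¹ • w) = 1 := by
  have hpos := sum_norm_sq_pos hw
  have hs : Real.sqrt (∑ i, ‖w i‖ ^ 2) ≠ 0 := (Real.sqrt_pos.mpr hpos).ne'
  have hsq : star w ⬝ᵥ w = ((Real.sqrt (∑ i, ‖w i‖ ^ 2) : ℝ) : ℂ) ^ 2 := by
    rw [star_dotProduct_self, ← Complex.ofReal_pow, Real.sq_sqrt hpos.le]
  refine ⟨_, hs, hsq, ?_⟩
  have hs' : ((Real.sqrt (∑ i, ‖w i‖ ^ 2) : ℝ) : ℂ) ≠ 0 := by exact_mod_cast hs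
  rw [star_smul, smul_dotProduct, dotProduct_smul, hsq]
  simp only [star_inv₀, RCLike.star_def, Complex.conj_ofReal, smul_eq_mul]
  field_simp

/-- Any vector can be mapped to a multiple of a given one by a reflection. -/
theorem exists_reflection (w₀ w₁ : α → ℂ) (h₀ : w₀ ≠ 0) :
    ∃ v : α → ℂ, star v ⬝ᵥ v = 1 ∧ (∃ p q : ℂ, v = p • w₀ + q • w₁) ∧
      ∃ c : ℂ, w₁ - (2 * (star v ⬝ᵥ w₁)) • v = c • w₀ := by
  obtain ⟨s, hs, hsq, hunit⟩ := exists_normalize h₀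
  have hs' : (s : ℂ) ≠ 0 := by exact_mod_cast hs
  -- For parallel vectors the difference used below could vanish; the reflection along `w₀` itself
  -- then only changes a sign. This covers `w₁ = 0`.
  by_cases hpar : ∃ a : ℂ, w₁ = a • w₀
  · obtain ⟨a, rfl⟩ := hpar
    refine ⟨_, hunit, ⟨(s : ℂ)⁻¹, 0, by simp⟩, -a, ?_⟩
    rw [star_smul, smul_dotProduct, dotProduct_smul, hsq]
    simp only [star_inv₀, RCLike.star_def, Complex.conj_ofReal, smul_eq_mul, smul_smul, ← sub_smul]
    congr 1
    field_simp
    ring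
  · push Not at hpar
    have h₁ : w₁ ≠ 0 := fun h => hpar 0 (by simp [h])
    obtain ⟨t, ht, htsq, -⟩ := exists_normalize h₁
    set g : ℂ := star w₀ ⬝ᵥ w₁ with hg
    -- Over the complex numbers a reflection along a difference exchanges two vectors only if their
    -- norms agree and their inner product is real; `ζ` corrects the phase.
    obtain ⟨ζ, hζ, r, hr⟩ : ∃ ζ : ℂ, star ζ * ζ = 1 ∧ ∃ r : ℝ, star ζ * g = r := by
      by_cases hg0 : g = 0
      · exact ⟨1, by simp, 0, by simp [hg0]⟩
      · have hn : (‖g‖ : ℂ) ≠ 0 := by simpa using hg0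
        have hgg : star g * g = (‖g‖ : ℂ) ^ 2 := Complex.conj_mul' g
        have hst : star (g / (‖g‖ : ℂ)) = star g / ‖g‖ := by
          simp [RCLike.star_def]
        refine ⟨g / ‖g‖, ?_, ‖g‖, ?_⟩
        · rw [hst, div_mul_div_comm, hgg]
          field_simp
        · rw [hst, div_mul_eq_mul_div, hgg]
          field_simp
    have hg' : star w₁ ⬝ᵥ w₀ = star g := by rw [hg, ← star_dotProduct]
    have hr' : ζ * star g = r := by
      have := congrArg star hr
      simpa [RCLike.star_def, mul_comm] using this
    -- The factor `t / s` gives the multiple of `w₀` the norm of `w₁`.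
    set u : α → ℂ := w₁ - (ζ * t / s) • w₀ with hu
    have hu0 : u ≠ 0 := fun h => hpar (ζ * t / s) (sub_eq_zero.mp h)
    have hst : star (ζ * t / s) = star ζ * t / s := by
      simp [RCLike.star_def]
    have huw : star u ⬝ᵥ w₁ = (t : ℂ) ^ 2 - t / s * r := by
      rw [hu, star_sub, star_smul, sub_dotProduct, smul_dotProduct, ← hg, htsq, hst, smul_eq_mul,
        ← hr]
      ring
    have huu : star u ⬝ᵥ u = 2 * ((t : ℂ) ^ 2 - t / s * r) := by
      have : star u ⬝ᵥ w₀ = star g - star ζ * t / s * (s : ℂ) ^ 2 := by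
        rw [hu, star_sub, star_smul, sub_dotProduct, smul_dotProduct, hg', hsq, hst, smul_eq_mul]
      conv_lhs => rw [hu, dotProduct_sub, dotProduct_smul, huw, this, smul_eq_mul]
      have h1 : ζ * t / s * (star g - star ζ * t / s * (s : ℂ) ^ 2) =
          t / s * (ζ * star g) - t ^ 2 * (star ζ * ζ) := by
        field_simp
      rw [h1, hr', hζ]
      ring
    obtain ⟨s', hs'0, hs'sq, hs'unit⟩ := exists_normalize hu0
    have hs'c : (s' : ℂ) ≠ 0 := by exact_mod_cast hs'0
    refine ⟨_, hs'unit, ⟨-((s' : ℂ)⁻¹ * (ζ * t / s)), (s' : ℂ)⁻¹, ?_⟩, ζ * t / s, ?_⟩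
    · rw [hu, smul_sub, smul_smul, neg_smul]
      abel
    · rw [star_smul, smul_dotProduct, huw, smul_smul, smul_eq_mul, star_inv₀, RCLike.star_def,
        Complex.conj_ofReal]
      have : 2 * ((s' : ℂ)⁻¹ * ((t : ℂ) ^ 2 - t / s * r)) * (s' : ℂ)⁻¹ = 1 := by
        have h2 : (t : ℂ) ^ 2 - t / s * r = (s' : ℂ) ^ 2 / 2 := by
          rw [← hs'sq, huu]
          ring
        rw [h2]
        field_simp
      rw [this, one_smul, hu]
      abel

theorem star_dotProduct_mulVec [DecidableEq α] {U : Matrix α α ℂ} (hU : Uᴴ * U = 1)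
    (v w : α → ℂ) : star (U *ᵥ v) ⬝ᵥ (U *ᵥ w) = star v ⬝ᵥ w := by
  rw [star_mulVec, ← dotProduct_mulVec, Matrix.mulVec_mulVec, hU, Matrix.one_mulVec]

end Reflections

/-! ### Householder gates, their conjugation and their support. -/

section Householder

variable {n c d : ℕ}

theorem householder_mulVec (v φ : Fin (2 ^ n) → ℂ) :
    householder v *ᵥ φ = φ - (2 * (star v ⬝ᵥ φ)) • v := by
  rw [householder, Matrix.sub_mulVec, Matrix.one_mulVec, Matrix.smul_mulVec, vecMulVec_mulVec]
  funext x
  simp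
  ring

theorem householder_isometry {v : Fin (2 ^ n) → ℂ} (hv : star v ⬝ᵥ v = 1) :
    (householder v)ᴴ * householder v = 1 := by
  have hH : (householder v)ᴴ = householder v := by
    simp [householder, conjTranspose_vecMulVec]
  rw [hH]
  apply Matrix.ext_of_mulVec_single
  intro y
  rw [← Matrix.mulVec_mulVec, Matrix.one_mulVec]
  generalize (Pi.single y 1 : Fin (2 ^ n) → ℂ) = φ
  rw [householder_mulVec, householder_mulVec, dotProduct_sub, dotProduct_smul, hv]
  funext x
  simp
  ring

/-- Conjugating a reflection by a unitary transports its vector; every cost estimate for a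
reflection below goes back to `H_0` in this way. -/
theorem mul_householder {U : Matrix (Fin (2 ^ n)) (Fin (2 ^ n)) ℂ} (hU : Uᴴ * U = 1)
    (v : Fin (2 ^ n) → ℂ) : U * householder v = householder (U *ᵥ v) * U := by
  apply Matrix.ext_of_mulVec_single
  intro y
  rw [← Matrix.mulVec_mulVec, ← Matrix.mulVec_mulVec]
  generalize (Pi.single y 1 : Fin (2 ^ n) → ℂ) = φ
  rw [householder_mulVec, householder_mulVec, Matrix.mulVec_sub, Matrix.mulVec_smul,
    star_mulVec, ← dotProduct_mulVec, Matrix.mulVec_mulVec, hU, Matrix.one_mulVec]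

theorem householder_smul {z : ℂ} (hz : star z * z = 1) (v : Fin (2 ^ n) → ℂ) :
    householder (z • v) = householder v := by
  have : vecMulVec (z • v) (star (z • v)) = vecMulVec v (star v) := by
    ext x y
    simp only [vecMulVec_apply, Pi.smul_apply, star_smul, smul_eq_mul]
    linear_combination v x * star v y * hz
  rw [householder, this, householder]

theorem isometry_mul {α : Type*} [Fintype α] [DecidableEq α] {U V : Matrix α α ℂ}
    (hU : Uᴴ * U = 1) (hV : Vᴴ * V = 1) : (U * V)ᴴ * (U * V) = 1 := by
  rw [Matrix.conjTranspose_mul, Matrix.mul_assoc, ← Matrix.mul_assoc Uᴴ, hU, Matrix.one_mul, hV]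

/-- Conjugation of a reflection by a unitary that is known up to its action on `|0⟩`. -/
theorem cnotCost_householder_mulVec_le {U : Matrix (Fin (2 ^ n)) (Fin (2 ^ n)) ℂ}
    (hU : Uᴴ * U = 1) (v : Fin (2 ^ n) → ℂ) :
    cnotCost c d (householder (U *ᵥ v)) ≤ 2 * cnotCost c d U + cnotCost c d (householder v) := by
  have : householder (U *ᵥ v) = U * (householder v * Uᴴ) := by
    rw [← Matrix.mul_assoc, mul_householder hU, Matrix.mul_assoc, mul_eq_one_comm.mp hU,
      Matrix.mul_one]
  rw [this]
  calc cnotCost c d (U * (householder v * Uᴴ))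
      ≤ cnotCost c d U + (cnotCost c d (householder v) + cnotCost c d Uᴴ) :=
        (cnotCost_mul_le le_rfl _ _).trans
          (add_le_add le_rfl (cnotCost_mul_le le_rfl _ _))
    _ ≤ cnotCost c d U + (cnotCost c d (householder v) + cnotCost c d U) := by
        gcongr
        exact cnotCost_conjTranspose_le hU
    _ = 2 * cnotCost c d U + cnotCost c d (householder v) := by ring

/-- `A` acts as the identity outside the rows in `S`. -/
def ActsOn (S : Set (Fin (2 ^ n))) (A : Matrix (Fin (2 ^ n)) (Fin (2 ^ n)) ℂ) : Prop :=
  (∀ (φ : Fin (2 ^ n) → ℂ) (x), x ∉ S → (A *ᵥ φ) x = φ x) ∧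
    ∀ φ : Fin (2 ^ n) → ℂ, (∀ x ∈ S, φ x = 0) → A *ᵥ φ = φ

theorem ActsOn.mul {S : Set (Fin (2 ^ n))} {A B : Matrix (Fin (2 ^ n)) (Fin (2 ^ n)) ℂ}
    (hA : ActsOn S A) (hB : ActsOn S B) : ActsOn S (A * B) := by
  refine ⟨fun φ x hx => ?_, fun φ hφ => ?_⟩
  · rw [← Matrix.mulVec_mulVec, hA.1 _ x hx, hB.1 _ x hx]
  · rw [← Matrix.mulVec_mulVec, hB.2 _ hφ, hA.2 _ hφ]

theorem ActsOn.mono {S T : Set (Fin (2 ^ n))} {A : Matrix (Fin (2 ^ n)) (Fin (2 ^ n)) ℂ}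
    (hA : ActsOn S A) (h : S ⊆ T) : ActsOn T A :=
  ⟨fun φ x hx => hA.1 φ x fun hx' => hx (h hx'), fun φ hφ => hA.2 φ fun x hx => hφ x (h hx)⟩

theorem actsOn_one (S : Set (Fin (2 ^ n))) : ActsOn S 1 := by
  simp [ActsOn]

theorem actsOn_householder {S : Set (Fin (2 ^ n))} {v : Fin (2 ^ n) → ℂ}
    (hv : ∀ x, x ∉ S → v x = 0) : ActsOn S (householder v) := by
  refine ⟨fun φ x hx => ?_, fun φ hφ => ?_⟩
  · simp [householder_mulVec, hv x hx]
  · have : star v ⬝ᵥ φ = 0 := by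
      refine Finset.sum_eq_zero fun x _ => ?_
      by_cases hx : x ∈ S
      · simp [hφ x hx]
      · simp [hv x hx]
    simp [householder_mulVec, this]

/-- A reflection supported on the rows in `S` clears all of these rows but one. -/
theorem exists_clearing_householder (S : Set (Fin (2 ^ n))) {i : Fin (2 ^ n)} (hi : i ∈ S)
    (w : Fin (2 ^ n) → ℂ) :
    ∃ v : Fin (2 ^ n) → ℂ, star v ⬝ᵥ v = 1 ∧ (∀ x, x ∉ S → v x = 0) ∧
      ∀ x ∈ S, x ≠ i → (householder v *ᵥ w) x = 0 := by
  classical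
  let w₁ : Fin (2 ^ n) → ℂ := fun x => if x ∈ S then w x else 0
  -- The vector lies in the span of the basis state `i` and of `w` restricted to `S`, hence is
  -- supported on `S`.
  obtain ⟨v, hv, ⟨p, q, hpq⟩, a, ha⟩ :=
    exists_reflection (Pi.single i 1 : Fin (2 ^ n) → ℂ) w₁ (by simp)
  have hvS : ∀ x, x ∉ S → v x = 0 := by
    intro x hx
    have hxi : x ≠ i := fun h => hx (h ▸ hi)
    simp [hpq, w₁, hx, hxi]
  refine ⟨v, hv, hvS, fun x hx hxi => ?_⟩
  have hdot : star v ⬝ᵥ w = star v ⬝ᵥ w₁ := by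
    refine Finset.sum_congr rfl fun y _ => ?_
    by_cases hy : y ∈ S
    · simp [w₁, hy]
    · simp [hvS y hy]
  have := congrFun ha x
  rw [householder_mulVec, hdot]
  simpa [w₁, hx, hxi] using this

end Householder

/-! ### Column-by-column reduction of an isometry. -/

section Reduction

variable {n m c d : ℕ}

theorem le_of_isIsometry {W : Matrix (Fin (2 ^ n)) (Fin (2 ^ m)) ℂ} (hW : IsIsometry W) :
    m ≤ n := by
  have h1 : Function.Injective W.mulVec := by
    intro v w h
    have := congrArg (Wᴴ *ᵥ ·) h
    simp only [Matrix.mulVec_mulVec] at this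
    rwa [show Wᴴ * W = 1 from hW, Matrix.one_mulVec, Matrix.one_mulVec] at this
  have := LinearMap.finrank_le_finrank_of_injective (f := W.mulVecLin) h1
  simp only [Module.finrank_fintype_fun_eq_card, Fintype.card_fin] at this
  exact (Nat.pow_le_pow_iff_right one_lt_two).mp this

theorem isIsometry_mul {U : Matrix (Fin (2 ^ n)) (Fin (2 ^ n)) ℂ} (hU : Uᴴ * U = 1)
    {W : Matrix (Fin (2 ^ n)) (Fin (2 ^ m)) ℂ} (hW : IsIsometry W) : IsIsometry (U * W) := by
  rw [IsIsometry, Matrix.conjTranspose_mul, Matrix.mul_assoc, ← Matrix.mul_assoc Uᴴ, hU,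
    Matrix.one_mul, hW]

/-- The rows between the diagonal and the envelope. -/
def band (e : Fin (2 ^ m) → ℕ) (i : Fin (2 ^ m)) : Set (Fin (2 ^ n)) :=
  {x | (i : ℕ) ≤ x ∧ (x : ℕ) ≤ e i}

/-- Column-by-column reduction below an envelope `e`. The predicate `Q` records any property of
the accumulated reduction. -/
theorem exists_reduction {W : Matrix (Fin (2 ^ n)) (Fin (2 ^ m)) ℂ} (hW : IsIsometry W)
    {e : Fin (2 ^ m) → ℕ} (he : Monotone e)
    (hWe : ∀ (j : Fin (2 ^ m)) (x : Fin (2 ^ n)), e j < (x : ℕ) → W x j = 0)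
    (Q : ℕ → Matrix (Fin (2 ^ n)) (Fin (2 ^ n)) ℂ → Prop) (hQ₀ : Q 0 1)
    (hQ : ∀ (i : Fin (2 ^ m)) (i' : Fin (2 ^ n)), (i' : ℕ) = i → (i : ℕ) ≤ e i →
      ∀ w : Fin (2 ^ n) → ℂ, (∀ x, x ∉ band e i → w x = 0) →
      ∀ B, Q i B → ∃ A : Matrix (Fin (2 ^ n)) (Fin (2 ^ n)) ℂ, Aᴴ * A = 1 ∧ ActsOn (band e i) A ∧
        (∀ x, x ≠ i' → (A *ᵥ w) x = 0) ∧ Q (i + 1) (A * B)) :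
    ∃ B : Matrix (Fin (2 ^ n)) (Fin (2 ^ n)) ℂ, Q (2 ^ m) B ∧ Bᴴ * B = 1 ∧ ∃ z : Fin (2 ^ m) → Circle,
      B * W = incl n m * diagGate z := by
  have hmn := le_of_isIsometry hW
  let up : Fin (2 ^ m) → Fin (2 ^ n) := Fin.castLE (Nat.pow_le_pow_right two_pos hmn)
  have hortho : ∀ B : Matrix (Fin (2 ^ n)) (Fin (2 ^ n)) ℂ, Bᴴ * B = 1 → ∀ j k,
      ∑ x, star ((B * W) x j) * (B * W) x k = if j = k then 1 else 0 := by
    intro B hB j k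
    have := congrFun (congrFun (isIsometry_mul hB hW) j) k
    rwa [Matrix.mul_apply, Matrix.one_apply] at this
  -- Invariant: the first `i` columns are reduced to their diagonal entries, and the others still
  -- vanish below the envelope.
  have main : ∀ i ≤ 2 ^ m, ∃ B : Matrix (Fin (2 ^ n)) (Fin (2 ^ n)) ℂ, Q i B ∧ Bᴴ * B = 1 ∧
      (∀ j : Fin (2 ^ m), (j : ℕ) < i → ∀ x, x ≠ up j → (B * W) x j = 0) ∧
      ∀ j : Fin (2 ^ m), i ≤ j → ∀ x : Fin (2 ^ n), e j < x → (B * W) x j = 0 := by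
    intro i
    induction i with
    | zero =>
      intro _
      exact ⟨1, hQ₀, by simp, by simp, fun j _ x hx => by simpa using hWe j x hx⟩
    | succ i ih =>
      intro hi
      obtain ⟨B, hQB, hB, hB1, hB2⟩ := ih (by omega)
      let i₀ : Fin (2 ^ m) := ⟨i, by omega⟩
      -- A reduced column has a single nonzero entry, so orthogonality to it forces a zero in that
      -- row.
      have hzero : ∀ k : Fin (2 ^ m), i ≤ k → ∀ x : Fin (2 ^ n), (x : ℕ) < i →
          (B * W) x k = 0 := by
        intro k hk x hx
        let j : Fin (2 ^ m) := ⟨x, by omega⟩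
        have hxj : up j = x := rfl
        have hjk : j ≠ k := fun h => by
          have : (j : ℕ) = k := congrArg Fin.val h
          simp only [j] at this
          omega
        have h1 : ∀ l, ∑ y, star ((B * W) y j) * (B * W) y l =
            star ((B * W) x j) * (B * W) x l := by
          intro l
          refine Finset.sum_eq_single x (fun y _ hy => ?_) (by simp)
          rw [hB1 j hx y (by rwa [hxj])]
          simp
        have h2 := hortho B hB j k
        have h3 := hortho B hB j j
        rw [h1, if_neg hjk] at h2
        rw [h1, if_pos rfl] at h3
        rcases mul_eq_zero.mp h2 with h | h
        · rw [h, zero_mul] at h3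
          exact absurd h3 zero_ne_one
        · exact h
      have hsupp : ∀ x, x ∉ band e i₀ → (B * W) x i₀ = 0 := by
        intro x hx
        simp only [band, Set.mem_ofPred_eq, not_and_or, not_le] at hx
        rcases hx with hx | hx
        · exact hzero i₀ le_rfl x hx
        · exact hB2 i₀ le_rfl x hx
      -- Otherwise the band would be empty and the column, a unit vector, would vanish.
      have hie : (i₀ : ℕ) ≤ e i₀ := by
        by_contra hcon
        have h3 := hortho B hB i₀ i₀
        rw [if_pos rfl, Finset.sum_eq_zero] at h3
        · exact zero_ne_one h3
        · intro x _
          rw [hsupp x fun hx => hcon (hx.1.trans hx.2)]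
          simp
      obtain ⟨A, hA, hAS, hAw, hQA⟩ :=
        hQ i₀ (up i₀) rfl hie (fun x => (B * W) x i₀) hsupp B hQB
      have hcol : ∀ x j, (A * B * W) x j = (A *ᵥ fun y => (B * W) y j) x := by
        intro x j
        rw [Matrix.mul_assoc]
        rfl
      refine ⟨A * B, hQA, isometry_mul hA hB, fun j hj x hx => ?_, fun j hj x hx => ?_⟩
      · rw [hcol]
        rcases Nat.lt_succ_iff_lt_or_eq.mp hj with hji | hji
        · rw [hAS.2 _ fun y hy => ?_, hB1 j hji x hx]
          refine hB1 j hji y fun h => ?_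
          have : i ≤ (y : ℕ) := hy.1
          have h' : (y : ℕ) = j := congrArg Fin.val h
          omega
        · obtain rfl : j = i₀ := Fin.ext hji
          exact hAw x hx
      · rw [hcol, hAS.1 _ x fun h => ?_, hB2 j (by omega) x hx]
        have h1 : (x : ℕ) ≤ e i₀ := h.2
        have h2 : e i₀ ≤ e j := he (show i₀ ≤ j from Fin.mk_le_of_le_val (by omega))
        omega
  obtain ⟨B, hQB, hB, hB1, -⟩ := main (2 ^ m) le_rfl
  have hz : ∀ j, ‖(B * W) (up j) j‖ = 1 := by
    intro j
    have h3 := hortho B hB j j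
    rw [if_pos rfl, Finset.sum_eq_single (up j)] at h3
    · rw [RCLike.star_def, Complex.conj_mul'] at h3
      have : ‖(B * W) (up j) j‖ ^ 2 = 1 := by exact_mod_cast h3
      exact (pow_eq_one_iff_of_nonneg (norm_nonneg _) two_ne_zero).mp this
    · intro y _ hy
      rw [hB1 j j.isLt y hy]
      simp
    · simp
  refine ⟨B, hQB, hB, fun j => ⟨(B * W) (up j) j, by simp [Submonoid.unitSphere, hz j]⟩, ?_⟩
  ext x j
  rw [incl_mul_apply]
  simp only [diagGate]
  by_cases hx : x = up j
  · subst hx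
    have : ((up j : Fin (2 ^ n)) : ℕ) < 2 ^ m := j.isLt
    rw [dif_pos this]
    simp [up]
  · rw [hB1 j j.isLt x hx]
    split_ifs with h
    · rw [Matrix.diagonal_apply_ne]
      rintro rfl
      exact hx rfl
    · rfl

theorem permMatrix_isometry (ρ : Equiv.Perm (Fin (2 ^ n))) :
    (ρ.permMatrix ℂ)ᴴ * ρ.permMatrix ℂ = 1 := by
  rw [conjTranspose_permMatrix, ← permMatrix_mul, mul_inv_cancel, permMatrix_one]

theorem diagGate_mul (z w : Fin (2 ^ n) → Circle) :
    diagGate z * diagGate w = diagGate (z * w) := by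
  simp [diagGate]

theorem diagGate_one : diagGate (1 : Fin (2 ^ n) → Circle) = 1 := by
  simp [diagGate]

theorem diagGate_conjTranspose (z : Fin (2 ^ n) → Circle) : (diagGate z)ᴴ = diagGate z⁻¹ := by
  rw [diagGate, Matrix.diagonal_conjTranspose, diagGate]
  congr 1
  funext i
  simp [← Circle.coe_inv_eq_conj]

theorem diagGate_isometry (z : Fin (2 ^ n) → Circle) : (diagGate z)ᴴ * diagGate z = 1 := by
  rw [diagGate_conjTranspose, diagGate_mul, inv_mul_cancel, diagGate_one]

/-- An infimum in `ℕ∞` over a nonempty family is attained, even when it is `⊤`. -/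
theorem exists_diagGate_cost (c d : ℕ) (π : Equiv.Perm (Fin (2 ^ n))) :
    ∃ z : Fin (2 ^ n) → Circle,
      cnotCost c d (diagGate z * π.permMatrix ℂ) ≤ costPermUpToDiag c d n := by
  obtain ⟨z, hz⟩ := ENat.exists_eq_iInf
    fun z : Fin (2 ^ n) → Circle => cnotCost c d (diagGate z * π.permMatrix ℂ)
  refine ⟨z, ?_⟩
  rw [hz]
  exact le_iSup (fun π : Equiv.Perm (Fin (2 ^ n)) => ⨅ z : Fin (2 ^ n) → Circle,
    cnotCost c d (diagGate z * π.permMatrix ℂ)) π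

theorem permuted_isometry {W : Matrix (Fin (2 ^ n)) (Fin (2 ^ m)) ℂ} (hW : IsIsometry W)
    (ρ : Equiv.Perm (Fin (2 ^ n))) (σ : Equiv.Perm (Fin (2 ^ m))) :
    IsIsometry (permuted ρ σ W) := by
  have h1 : IsIsometry (ρ.permMatrix ℂ * W) := isIsometry_mul (permMatrix_isometry ρ) hW
  rw [IsIsometry, permuted, Matrix.conjTranspose_mul, Matrix.mul_assoc,
    ← Matrix.mul_assoc _ _ (σ.permMatrix ℂ), h1, Matrix.one_mul, permMatrix_isometry]

/-- A reduction of the permuted isometry, up to a diagonal gate, to the gate `G` on the states of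
`m` qubits gives an implementation of the isometry. -/
theorem cnotCost_le_of_reduction {W : Matrix (Fin (2 ^ n)) (Fin (2 ^ m)) ℂ} (hW : IsIsometry W)
    (ρ : Equiv.Perm (Fin (2 ^ n))) (σ : Equiv.Perm (Fin (2 ^ m))) (t : ℕ∞)
    (h : ∀ W' : Matrix (Fin (2 ^ n)) (Fin (2 ^ m)) ℂ, IsIsometry W' →
      (∀ x j, permuted ρ σ W x j = 0 → W' x j = 0) →
      ∃ F G : Matrix (Fin (2 ^ n)) (Fin (2 ^ n)) ℂ, Fᴴ * F = 1 ∧ cnotCost c d F ≤ t ∧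
        cnotCost c d G = 0 ∧ ∃ z : Fin (2 ^ m) → Circle, F * W' = G * (incl n m * diagGate z)) :
    cnotCost c d W ≤
      costPermUpToDiag c d n + t + costPermUpToDiag c d m + costDiag c d m := by
  have hmn := le_of_isIsometry hW
  obtain ⟨z₁, hz₁⟩ := exists_diagGate_cost c d ρ
  obtain ⟨z₂, hz₂⟩ := exists_diagGate_cost c d σ⁻¹
  set P := diagGate z₁ * ρ.permMatrix ℂ with hP
  set R := diagGate z₂ * σ⁻¹.permMatrix ℂ with hR
  have hPi : Pᴴ * P = 1 := isometry_mul (diagGate_isometry _) (permMatrix_isometry _)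
  -- The permutation comes with an uncontrolled diagonal gate, but this only rescales rows and so
  -- preserves all zeros.
  obtain ⟨F, G, hF, hFt, hG, z, hz⟩ := h (diagGate z₁ * permuted ρ σ W)
    (isIsometry_mul (diagGate_isometry _) (permuted_isometry hW ρ σ)) (fun x j hx => by
      rw [diagGate, Matrix.diagonal_mul, hx, mul_zero])
  -- The column permutation is undone by `R` up to the phases `z₂`, which merge with the phases `z`
  -- left by the reduction.
  have hWeq : W = Pᴴ * (Fᴴ * (G * (lowLift hmn (diagGate (z * z₂⁻¹)) *
      (lowLift hmn R * incl n m)))) := by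
    have hσ : σ.permMatrix ℂ * σ⁻¹.permMatrix ℂ = 1 := by
      rw [← permMatrix_mul, inv_mul_cancel, permMatrix_one]
    have h1 : lowLift hmn (diagGate (z * z₂⁻¹)) * (lowLift hmn R * incl n m) =
        incl n m * diagGate z * σ⁻¹.permMatrix ℂ := by
      rw [lowLift_mul_incl, ← Matrix.mul_assoc, lowLift_mul_incl, hR, Matrix.mul_assoc,
        ← Matrix.mul_assoc (diagGate _) (diagGate _), diagGate_mul, inv_mul_cancel_right,
        Matrix.mul_assoc]
    have h2 : diagGate z₁ * permuted ρ σ W = P * W * σ.permMatrix ℂ := by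
      rw [permuted, hP]
      simp only [Matrix.mul_assoc]
    rw [h1, ← Matrix.mul_assoc G, ← hz, h2]
    calc W = (Pᴴ * P) * W := by rw [hPi, Matrix.one_mul]
      _ = Pᴴ * ((Fᴴ * F) * (P * W * (σ.permMatrix ℂ * σ⁻¹.permMatrix ℂ))) := by
        rw [hF, hσ, Matrix.mul_one, Matrix.one_mul, Matrix.mul_assoc]
      _ = _ := by simp only [Matrix.mul_assoc]
  rw [hWeq]
  calc _ ≤ cnotCost c d Pᴴ + (cnotCost c d Fᴴ + (cnotCost c d G +
        (cnotCost c d (lowLift hmn (diagGate (z * z₂⁻¹))) +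
          (cnotCost c d (lowLift hmn R) + cnotCost c d (incl n m))))) := by
        refine (cnotCost_mul_le hmn _ _).trans (add_le_add le_rfl ?_)
        refine (cnotCost_mul_le hmn _ _).trans (add_le_add le_rfl ?_)
        refine (cnotCost_mul_le hmn _ _).trans (add_le_add le_rfl ?_)
        refine (cnotCost_mul_le hmn _ _).trans (add_le_add le_rfl ?_)
        exact cnotCost_mul_le hmn _ _
    _ ≤ costPermUpToDiag c d n + (t + (0 + (costDiag c d m + (costPermUpToDiag c d m + 0)))) := by
        refine add_le_add ((cnotCost_conjTranspose_le hPi).trans hz₁) ?_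
        refine add_le_add ((cnotCost_conjTranspose_le hF).trans hFt) ?_
        refine add_le_add hG.le ?_
        refine add_le_add ((cnotCost_lowLift_le hmn _).trans ?_) ?_
        · exact le_iSup (fun z : Fin (2 ^ m) → Circle => cnotCost c d (diagGate z)) _
        · exact add_le_add ((cnotCost_lowLift_le hmn _).trans hz₂) (cnotCost_incl hmn).le
    _ = _ := by
        rw [zero_add, add_zero]
        ring

end Reduction

/-! ### The first bound: shifting the bands by decrements. -/

section Decrement

variable {n m c d : ℕ}

theorem decGate_mulVec (φ : Fin (2 ^ n) → ℂ) (x : Fin (2 ^ n)) :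
    (decGate n *ᵥ φ) x = φ (x + 1) := by
  simp [decGate, mulVec, dotProduct]

theorem decGate_eq_permMatrix : decGate n = (Equiv.addRight (1 : Fin (2 ^ n))).permMatrix ℂ := by
  apply Matrix.ext_of_mulVec_single
  intro y
  rw [permMatrix_mulVec]
  funext x
  rw [decGate_mulVec]
  rfl

theorem decGate_isometry : (decGate n)ᴴ * decGate n = 1 := by
  rw [decGate_eq_permMatrix]
  exact permMatrix_isometry _

theorem decGate_pow_isometry (k : ℕ) : (decGate n ^ k)ᴴ * decGate n ^ k = 1 := by
  induction k with
  | zero => simp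
  | succ k ih =>
    rw [pow_succ]
    exact isometry_mul ih decGate_isometry

theorem decGate_pow_mulVec (k : ℕ) (φ : Fin (2 ^ n) → ℂ) (x : Fin (2 ^ n)) :
    (decGate n ^ k *ᵥ φ) x = φ (x + Fin.ofNat (2 ^ n) k) := by
  induction k generalizing x with
  | zero =>
    simp only [pow_zero, Matrix.one_mulVec]
    congr 1
    ext
    simp
  | succ k ih =>
    rw [pow_succ', ← Matrix.mulVec_mulVec, decGate_mulVec, ih]
    congr 1
    ext
    simp [Fin.val_add, Nat.add_assoc, Nat.add_comm 1]

/-- Flip all qubits. -/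
def flipAll (n : ℕ) : Matrix (Fin (2 ^ n)) (Fin (2 ^ n)) ℂ :=
  Fin.revPerm.permMatrix ℂ

theorem flipAll_mulVec (φ : Fin (2 ^ n) → ℂ) (x : Fin (2 ^ n)) :
    (flipAll n *ᵥ φ) x = φ x.rev := by
  rw [flipAll, permMatrix_mulVec]
  rfl

theorem dotProduct_ketZero : star (ketZero n) ⬝ᵥ ketZero n = 1 := by
  simp [ketZero]

/-- Finiteness lets `≤` be replaced by `<` after adding one, and a strict bound on an infimum yields
a witness. -/
theorem exists_statePrep_cost {s : ℕ} (h : costStatePrep c d s ≠ ⊤) {v : Fin (2 ^ s) → ℂ}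
    (hv : star v ⬝ᵥ v = 1) :
    ∃ U : Matrix (Fin (2 ^ s)) (Fin (2 ^ s)) ℂ, Uᴴ * U = 1 ∧ U *ᵥ ketZero s = v ∧
      cnotCost c d U ≤ costStatePrep c d s := by
  have hv' : ∑ i, ‖v i‖ ^ 2 = 1 := by
    rw [star_dotProduct_self] at hv
    exact_mod_cast hv
  have hlt : (⨅ (U : Matrix.unitaryGroup (Fin (2 ^ s)) ℂ)
      (_ : (U : Matrix (Fin (2 ^ s)) (Fin (2 ^ s)) ℂ).mulVec (ketZero s) = v),
      cnotCost c d (U : Matrix (Fin (2 ^ s)) (Fin (2 ^ s)) ℂ)) < costStatePrep c d s + 1 := by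
    refine lt_of_le_of_lt ?_ ((ENat.lt_add_one_iff h).mpr le_rfl)
    exact le_iSup₂ (f := fun (v : Fin (2 ^ s) → ℂ) (_ : ∑ i, ‖v i‖ ^ 2 = 1) =>
      ⨅ (U : Matrix.unitaryGroup (Fin (2 ^ s)) ℂ)
        (_ : (U : Matrix (Fin (2 ^ s)) (Fin (2 ^ s)) ℂ).mulVec (ketZero s) = v),
        cnotCost c d (U : Matrix (Fin (2 ^ s)) (Fin (2 ^ s)) ℂ)) v hv'
  simp only [iInf_lt_iff] at hlt
  obtain ⟨U, hU, hlt⟩ := hlt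
  exact ⟨U, Matrix.mem_unitaryGroup_iff'.mp U.2, hU, (ENat.lt_add_one_iff h).mp hlt⟩

theorem incl_mulVec_ketZero {s : ℕ} : incl n s *ᵥ ketZero s = ketZero n := by
  funext x
  rw [incl_mulVec]
  simp only [ketZero, Pi.single_apply, Fin.ext_iff]
  have h2 : ((0 : Fin (2 ^ n)) : ℕ) = 0 := rfl
  have h3 : ((0 : Fin (2 ^ s)) : ℕ) = 0 := rfl
  have h4 : 0 < 2 ^ s := by positivity
  rw [h2, h3]
  by_cases h5 : (x : ℕ) = 0
  · simp [h5]
  · simp [h5]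

/-- The reflection along a state of the `s` least significant qubits. -/
theorem cnotCost_householder_incl_le {s : ℕ} (hs : s ≤ n) {v : Fin (2 ^ s) → ℂ}
    (hv : star v ⬝ᵥ v = 1) :
    cnotCost c d (householder (incl n s *ᵥ v)) ≤ 2 * costStatePrep c d s + costH0 c d n := by
  by_cases h : costStatePrep c d s = ⊤
  · simp [h]
  obtain ⟨U, hU, rfl, hUc⟩ := exists_statePrep_cost h hv
  rw [← lowLift_mulVec_incl hs, incl_mulVec_ketZero]
  refine (cnotCost_householder_mulVec_le (lowLift_isometry hs hU) _).trans ?_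
  have := (cnotCost_lowLift_le hs U).trans hUc
  rw [costH0]
  gcongr

theorem exists_eq_incl_mulVec {s : ℕ} (hs : s ≤ n) {v : Fin (2 ^ n) → ℂ}
    (hv : star v ⬝ᵥ v = 1) (hvs : ∀ x : Fin (2 ^ n), 2 ^ s ≤ (x : ℕ) → v x = 0) :
    ∃ w : Fin (2 ^ s) → ℂ, star w ⬝ᵥ w = 1 ∧ v = incl n s *ᵥ w := by
  let up : Fin (2 ^ s) → Fin (2 ^ n) := Fin.castLE (Nat.pow_le_pow_right two_pos hs)
  have hvw : v = incl n s *ᵥ fun r => v (up r) := by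
    funext x
    rw [incl_mulVec]
    split_ifs with h
    · rfl
    · exact hvs x (not_lt.mp h)
  refine ⟨fun r => v (up r), ?_, hvw⟩
  rw [← hv]
  have hinj : Function.Injective up := Fin.castLE_injective _
  refine Fintype.sum_of_injective up hinj _ _ (fun x hx => ?_) fun r => rfl
  rw [hvs x, mul_zero]
  by_contra h
  exact hx ⟨⟨x, not_le.mp h⟩, rfl⟩

/-- The position of the diagonal after `2 ^ m` decrements. -/
theorem decGate_pow_mul_incl (hmn : m ≤ n) :
    decGate n ^ 2 ^ m * incl n m = flipAll n * lowLift hmn (flipAll m) * incl n m := by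
  rw [Matrix.mul_assoc, lowLift_mul_incl]
  apply Matrix.ext_of_mulVec_single
  intro y
  simp only [← Matrix.mulVec_mulVec]
  generalize (Pi.single y 1 : Fin (2 ^ m) → ℂ) = φ
  funext x
  have hle : 2 ^ m ≤ 2 ^ n := Nat.pow_le_pow_right two_pos hmn
  rw [decGate_pow_mulVec, flipAll_mulVec, incl_mulVec, incl_mulVec]
  have hval : ((x + Fin.ofNat (2 ^ n) (2 ^ m) : Fin (2 ^ n)) : ℕ) = (x + 2 ^ m) % 2 ^ n := by
    simp [Fin.val_add]
  have hx := x.isLt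
  have hpos : 0 < 2 ^ m := by positivity
  -- Both sides are supported on the last `2 ^ m` rows, where the shift wraps around. There it
  -- amounts to setting the `n - m` upper bits to one, that is, to flipping all bits and then the
  -- lower ones back.
  rcases Nat.lt_or_ge (x + 2 ^ m) (2 ^ n) with h | h
  · rw [Nat.mod_eq_of_lt h] at hval
    rw [dif_neg (by omega), dif_neg (by rw [Fin.val_rev]; omega)]
  · have : ((x : ℕ) + 2 ^ m) % 2 ^ n = x + 2 ^ m - 2 ^ n := by
      rw [Nat.mod_eq_sub_mod h, Nat.mod_eq_of_lt (by omega)]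
    rw [this] at hval
    rw [dif_pos (by omega), dif_pos (by rw [Fin.val_rev]; omega), flipAll_mulVec]
    congr 1
    ext
    simp only [hval, Fin.val_rev]
    omega

/-- Flip the qubits in a mask. -/
theorem exists_circuit_flip {ι : Type} [Fintype ι] [DecidableEq ι] (u : ι → Fin 2) :
    ∃ C : Circuit ι, C.cnotCount = 0 ∧ ∀ ψ x, (C.mat *ᵥ ψ) x = ψ (x + u) := by
  let X : Matrix.unitaryGroup (Fin 2) ℂ := ⟨!![0, 1; 1, 0], by
    rw [Matrix.mem_unitaryGroup_iff]
    ext i j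
    fin_cases i <;> fin_cases j <;> simp [Matrix.mul_apply]⟩
  have hX : ∀ (q : ι) (ψ : (ι → Fin 2) → ℂ) (x : ι → Fin 2),
      ((Gate.single q X).mat *ᵥ ψ) x = ψ (update x q (x q + 1)) := by
    intro q ψ x
    rw [Gate.single_mulVec, Fin.sum_univ_two]
    generalize x q = b
    fin_cases b <;> simp [X]
  have key : ∀ S : Finset ι, ∃ C : Circuit ι, C.cnotCount = 0 ∧
      ∀ ψ x, (C.mat *ᵥ ψ) x = ψ (fun i => if i ∈ S then x i + u i else x i) := by
    intro S
    induction S using Finset.induction_on with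
    | empty => exact ⟨[], rfl, by simp [Circuit.mat]⟩
    | insert a S ha ih =>
      obtain ⟨C, hC, hCψ⟩ := ih
      by_cases hua : u a = 0
      · refine ⟨C, hC, fun ψ x => ?_⟩
        rw [hCψ]
        congr 1
        funext i
        by_cases hi : i = a
        · subst hi; simp [ha, hua]
        · simp [hi]
      · have hua' : u a = 1 := by
          revert hua
          generalize u a = b
          revert b
          decide
        refine ⟨Gate.single a X :: C, by simpa [Circuit.cnotCount, Gate.isCnot] using hC,
          fun ψ x => ?_⟩
        rw [Circuit.cons_mulVec, hCψ, hX]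
        congr 1
        funext i
        by_cases hi : i = a
        · subst hi; simp [ha, hua']
        · simp [hi]
  obtain ⟨C, hC, hCψ⟩ := key Finset.univ
  exact ⟨C, hC, fun ψ x => by rw [hCψ]; simp; rfl⟩

/-- The bits of `x.rev = 2 ^ n - 1 - x` are the complements of those of `x`. -/
theorem cnotCost_flipAll : cnotCost c d (flipAll n) = 0 := by
  obtain ⟨C, hC, hCψ⟩ := exists_circuit_flip (fun _ : Fin n => (1 : Fin 2))
  have : C.dataMat = flipAll n := by
    apply Matrix.ext_of_mulVec_single
    intro y
    generalize (Pi.single y 1 : Fin (2 ^ n) → ℂ) = φ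
    funext x
    rw [Circuit.dataMat_mulVec, hCψ, flipAll_mulVec]
    congr 1
    rw [Equiv.symm_apply_eq]
    funext i
    apply Fin.ext
    have hb : ∀ b : Fin 2, ((b + 1 : Fin 2) : ℕ) = 1 - b := by decide
    rw [Pi.add_apply, hb, bits_val, bits_val, Fin.val_rev]
    have := Nat.testBit_two_pow_sub_succ x.isLt i
    rw [Nat.testBit_eq_decide_div_mod_eq, Nat.testBit_eq_decide_div_mod_eq] at this
    have h1 : (2 ^ n - ((x : ℕ) + 1)) / 2 ^ (i : ℕ) % 2 = 1 ↔ ¬ (x : ℕ) / 2 ^ (i : ℕ) % 2 = 1 := by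
      simpa [← decide_not] using this
    have h2 := Nat.mod_two_eq_zero_or_one ((x : ℕ) / 2 ^ (i : ℕ))
    have h3 := Nat.mod_two_eq_zero_or_one ((2 ^ n - ((x : ℕ) + 1)) / 2 ^ (i : ℕ))
    omega
  rw [← this]
  have := cnotCost_dataMat_le (c := c) (d := d) C
  simpa [hC] using this

/-- The quantity tracked through the reduction is the cost of `decGate n ^ i * B`, not of `B`: in
this shifted frame the `i`-th diagonal position is row `0`, and the next step needs only one more
decrement. -/
theorem costCol_reduction {W : Matrix (Fin (2 ^ n)) (Fin (2 ^ m)) ℂ} (hW : IsIsometry W)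
    (ρ : Equiv.Perm (Fin (2 ^ n))) (σ : Equiv.Perm (Fin (2 ^ m))) :
    cnotCost c d W ≤ costPermUpToDiag c d n
      + ∑ i : Fin (2 ^ m), costCol c d n (logHeight (permuted ρ σ W) i)
      + costPermUpToDiag c d m + costDiag c d m := by
  have hmn := le_of_isIsometry hW
  refine cnotCost_le_of_reduction hW ρ σ _ fun W' hW' hzero => ?_
  set e := env (permuted ρ σ W) with he
  have hmono := (isLeast_env (permuted ρ σ W)).1.1
  have hspec := (isLeast_env (permuted ρ σ W)).1.2
  -- The value `0` beyond the last column is never used; the extension to `ℕ` allows induction on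
  -- partial sums.
  let t : ℕ → ℕ∞ := fun i =>
    if h : i < 2 ^ m then costCol c d n (logHeight (permuted ρ σ W) ⟨i, h⟩) else 0
  suffices h : ∃ B : Matrix (Fin (2 ^ n)) (Fin (2 ^ n)) ℂ,
      cnotCost c d (decGate n ^ 2 ^ m * B) ≤ ∑ j ∈ Finset.range (2 ^ m), t j ∧
      Bᴴ * B = 1 ∧ ∃ z : Fin (2 ^ m) → Circle, B * W' = incl n m * diagGate z by
    obtain ⟨B, hB, hBi, z, hz⟩ := h
    refine ⟨decGate n ^ 2 ^ m * B, flipAll n * lowLift hmn (flipAll m),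
      isometry_mul (decGate_pow_isometry _) hBi, hB.trans (le_of_eq ?_), ?_, z, ?_⟩
    · rw [← Fin.sum_univ_eq_sum_range]
      refine Finset.sum_congr rfl fun i _ => ?_
      simp [t]
    · refine le_antisymm ((cnotCost_mul_le le_rfl _ _).trans ?_) zero_le
      rw [cnotCost_flipAll, zero_add]
      exact (cnotCost_lowLift_le hmn _).trans cnotCost_flipAll.le
    · rw [Matrix.mul_assoc, hz, ← Matrix.mul_assoc, decGate_pow_mul_incl hmn, Matrix.mul_assoc]
  · refine exists_reduction hW' hmono (fun j x hx => hzero x j (hspec j x hx))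
      (fun i B => cnotCost c d (decGate n ^ i * B) ≤ ∑ j ∈ Finset.range i, t j)
      (by simp [cnotCost_one]) fun i i' hi' hie w hw B hB => ?_
    have hmem : i' ∈ (band e i : Set (Fin (2 ^ n))) := ⟨hi'.ge, hi'.trans_le hie⟩
    obtain ⟨v, hv, hvS, hvw⟩ := exists_clearing_householder (band e i) hmem w
    refine ⟨householder v, householder_isometry hv, actsOn_householder hvS, fun x hx => ?_, ?_⟩
    · by_cases hxS : x ∈ (band e i : Set (Fin (2 ^ n)))
      · exact hvw x hxS hx
      · rw [(actsOn_householder hvS).1 w x hxS, hw x hxS]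
    · have hs : logHeight (permuted ρ σ W) i ≤ n := by
        refine Nat.clog_le_of_le_pow ?_
        have : e i ≤ 2 ^ n - 1 := Nat.sInf_le fun k _ x hx => absurd x.isLt (by omega)
        have hpos : 0 < 2 ^ n := by positivity
        simp only [← he]
        omega
      -- The shift moves the band to the rows `0, …, e i - i`. Rows that wrap around come from rows
      -- above the diagonal, where `v` vanishes.
      have hsupp : ∀ x : Fin (2 ^ n), 2 ^ logHeight (permuted ρ σ W) i ≤ (x : ℕ) →
          (decGate n ^ (i : ℕ) *ᵥ v) x = 0 := by
        intro x hx
        rw [decGate_pow_mulVec]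
        apply hvS
        have h1 : 1 + e i - i ≤ 2 ^ logHeight (permuted ρ σ W) i :=
          Nat.le_pow_clog one_lt_two _
        have hval : ((x + Fin.ofNat (2 ^ n) i : Fin (2 ^ n)) : ℕ) = (x + i) % 2 ^ n := by
          simp [Fin.val_add]
        rintro ⟨h2, h3⟩
        rw [hval] at h2 h3
        have hi'n := i'.isLt
        have hxn := x.isLt
        rcases Nat.lt_or_ge (x + i) (2 ^ n) with h | h
        · rw [Nat.mod_eq_of_lt h] at h3
          omega
        · rw [Nat.mod_eq_sub_mod h, Nat.mod_eq_of_lt (by omega)] at h2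
          omega
      have hunit : star (decGate n ^ (i : ℕ) *ᵥ v) ⬝ᵥ (decGate n ^ (i : ℕ) *ᵥ v) = 1 := by
        rw [star_dotProduct_mulVec (decGate_pow_isometry _), hv]
      obtain ⟨v', hv', hvv'⟩ := exists_eq_incl_mulVec hs hunit hsupp
      -- Moving the reflection past the `i` decrements replaces `v` by its shifted version.
      have heq : decGate n ^ ((i : ℕ) + 1) * (householder v * B) =
          decGate n * (householder (incl n _ *ᵥ v') * (decGate n ^ (i : ℕ) * B)) := by
        rw [← hvv', ← Matrix.mul_assoc (householder _), ← mul_householder (decGate_pow_isometry _),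
          pow_succ']
        simp only [Matrix.mul_assoc]
      rw [heq, Finset.sum_range_succ]
      calc _ ≤ costDec c d n + (cnotCost c d (householder (incl n _ *ᵥ v')) +
            cnotCost c d (decGate n ^ (i : ℕ) * B)) :=
            (cnotCost_mul_le le_rfl _ _).trans
              (add_le_add le_rfl (cnotCost_mul_le le_rfl _ _))
        _ ≤ costDec c d n + ((2 * costStatePrep c d (logHeight (permuted ρ σ W) i) +
              costH0 c d n) + ∑ j ∈ Finset.range i, t j) := by
            gcongr
            exact cnotCost_householder_incl_le hs hv'
        _ = _ := by
            have : t i = costCol c d n (logHeight (permuted ρ σ W) i) := by simp [t]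
            rw [this, costCol]
            ring

end Decrement

/-! ### Toggles and sign gates: multi-controlled gates with borrowed qubits. -/

section Classical

variable {ι : Type} [Fintype ι] [DecidableEq ι]

/-- Some circuit with at most `k` controlled-nots permutes the amplitudes by `f`. -/
def HasPull (k : ℕ) (f : (ι → Fin 2) → ι → Fin 2) : Prop :=
  ∃ C : Circuit ι, C.cnotCount ≤ k ∧ ∀ ψ x, (C.mat *ᵥ ψ) x = ψ (f x)

/-- Some circuit with at most `k` controlled-nots multiplies the amplitudes by `φ`. -/
def HasDiag (k : ℕ) (φ : (ι → Fin 2) → ℂ) : Prop :=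
  ∃ C : Circuit ι, C.cnotCount ≤ k ∧ ∀ ψ x, (C.mat *ᵥ ψ) x = φ x * ψ x

/-- Amplitudes are pulled back, so the circuit applied first contributes the outer map. -/
theorem HasPull.comp {k l : ℕ} {f g : (ι → Fin 2) → ι → Fin 2} (hf : HasPull k f)
    (hg : HasPull l g) : HasPull (k + l) (f ∘ g) := by
  obtain ⟨C, hC, hCψ⟩ := hf
  obtain ⟨D, hD, hDψ⟩ := hg
  refine ⟨C ++ D, ?_, fun ψ x => ?_⟩
  · rw [Circuit.cnotCount_append]
    omega
  · rw [Circuit.append_mulVec, hDψ, hCψ]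
    rfl

theorem HasPull.mono {k l : ℕ} {f : (ι → Fin 2) → ι → Fin 2} (hf : HasPull k f) (h : k ≤ l) :
    HasPull l f := by
  obtain ⟨C, hC, hCψ⟩ := hf
  exact ⟨C, hC.trans h, hCψ⟩

theorem HasDiag.mono {k l : ℕ} {φ : (ι → Fin 2) → ℂ} (hφ : HasDiag k φ) (h : k ≤ l) :
    HasDiag l φ := by
  obtain ⟨C, hC, hCψ⟩ := hφ
  exact ⟨C, hC.trans h, hCψ⟩

theorem HasDiag.mul {k l : ℕ} {φ χ : (ι → Fin 2) → ℂ} (hφ : HasDiag k φ) (hχ : HasDiag l χ) :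
    HasDiag (k + l) fun x => φ x * χ x := by
  obtain ⟨C, hC, hCψ⟩ := hφ
  obtain ⟨D, hD, hDψ⟩ := hχ
  refine ⟨D ++ C, ?_, fun ψ x => ?_⟩
  · rw [Circuit.cnotCount_append]
    omega
  · rw [Circuit.append_mulVec, hCψ, hDψ, mul_assoc]

theorem HasDiag.conj {k l : ℕ} {φ : (ι → Fin 2) → ℂ} {f : (ι → Fin 2) → ι → Fin 2}
    (hφ : HasDiag k φ) (hf : HasPull l f) (hff : ∀ x, f (f x) = x) :
    HasDiag (k + 2 * l) fun x => φ (f x) := by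
  obtain ⟨C, hC, hCψ⟩ := hφ
  obtain ⟨D, hD, hDψ⟩ := hf
  refine ⟨D ++ (C ++ D), ?_, fun ψ x => ?_⟩
  · rw [Circuit.cnotCount_append, Circuit.cnotCount_append]
    omega
  · rw [Circuit.append_mulVec, Circuit.append_mulVec, hDψ, hCψ, hDψ, hff]

theorem hasPull_cnot {a t : ι} (h : a ≠ t) : HasPull 1 fun x => update x t (x t + x a) :=
  ⟨[Gate.cnot a t h], by simp [Circuit.cnotCount, Gate.isCnot], fun ψ x => by
    rw [Circuit.singleton_mulVec, Gate.cnot_mulVec]⟩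

theorem hasPull_add (u : ι → Fin 2) : HasPull 0 fun x => x + u := by
  obtain ⟨C, hC, hCψ⟩ := exists_circuit_flip u
  exact ⟨C, hC.le, hCψ⟩

theorem hasDiag_phase (q : ι) (w : Circle) :
    HasDiag 0 fun x => if x q = 1 then (w : ℂ) else 1 := by
  have hw : (w : ℂ) * (starRingEnd ℂ) w = 1 := by
    rw [← Circle.coe_inv_eq_conj, ← Circle.coe_mul, mul_inv_cancel, Circle.coe_one]
  let U : Matrix.unitaryGroup (Fin 2) ℂ := ⟨!![1, 0; 0, (w : ℂ)], by
    rw [Matrix.mem_unitaryGroup_iff]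
    ext i j
    fin_cases i <;> fin_cases j <;> simp [Matrix.mul_apply, hw]⟩
  refine ⟨[Gate.single q U], by simp [Circuit.cnotCount, Gate.isCnot], fun ψ x => ?_⟩
  rw [Circuit.singleton_mulVec, Gate.single_mulVec, Fin.sum_univ_two]
  conv_rhs => rw [← update_eq_self q x]
  simp only [update_self]
  generalize x q = b
  fin_cases b <;> simp [U]

/-- Flip the qubit `t` if `p` holds. -/
def toggle (t : ι) (p : (ι → Fin 2) → Prop) [DecidablePred p] (x : ι → Fin 2) : ι → Fin 2 :=
  update x t (x t + if p x then 1 else 0)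

theorem toggle_congr (t : ι) {p r : (ι → Fin 2) → Prop} [DecidablePred p] [DecidablePred r]
    (h : ∀ x, p x ↔ r x) : toggle t p = toggle t r := by
  funext x
  simp only [toggle, h]

theorem hadamard_aux : ∃ s : ℂ, s * s = 1 / 2 ∧ star s = s := by
  refine ⟨((Real.sqrt (1 / 2) : ℝ) : ℂ), ?_, Complex.conj_ofReal _⟩
  rw [← Complex.ofReal_mul, Real.mul_self_sqrt (by norm_num)]
  norm_num

theorem exists_hadamard (q : ι) : ∃ (g : Gate ι) (s : ℂ), g.isCnot = false ∧ s * s = 1 / 2 ∧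
    ∀ ψ x, (g.mat *ᵥ ψ) x =
      s * (ψ (update x q 0) + (if x q = 1 then -1 else 1) * ψ (update x q 1)) := by
  obtain ⟨s, hs, hs'⟩ := hadamard_aux
  have hs'' : (starRingEnd ℂ) s = s := hs'
  let U : Matrix.unitaryGroup (Fin 2) ℂ := ⟨!![s, s; s, -s], by
    rw [Matrix.mem_unitaryGroup_iff]
    ext i j
    fin_cases i <;> fin_cases j <;> simp [Matrix.mul_apply, hs'', hs] <;> norm_num⟩
  refine ⟨Gate.single q U, s, rfl, hs, fun ψ x => ?_⟩
  rw [Gate.single_mulVec, Fin.sum_univ_two]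
  generalize x q = b
  fin_cases b <;> simp [U] <;> ring

/-- A Hadamard gate on either side turns a sign on `t` into a flip of `t`; the condition must be the
same for both values of `t`. -/
theorem HasDiag.hasPull_toggle {k : ℕ} {t : ι} {p : (ι → Fin 2) → Prop}
    [DecidablePred p] (hp : ∀ x b, p (update x t b) ↔ p x)
    (h : HasDiag k fun x => if p x ∧ x t = 1 then -1 else 1) : HasPull k (toggle t p) := by
  obtain ⟨C, hC, hCψ⟩ := h
  obtain ⟨g, s, hg, hs, hgψ⟩ := exists_hadamard t
  refine ⟨[g] ++ (C ++ [g]), ?_, fun ψ x => ?_⟩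
  · rw [Circuit.cnotCount_append, Circuit.cnotCount_append]
    simpa [Circuit.cnotCount, hg] using hC
  · rw [Circuit.append_mulVec, Circuit.append_mulVec, Circuit.singleton_mulVec,
      Circuit.singleton_mulVec, hgψ, hCψ, hCψ, hgψ, hgψ, toggle]
    simp only [hp, update_self, update_idem]
    generalize x t = b
    by_cases hpx : p x <;> fin_cases b <;> simp [hpx] <;>
      first
        | linear_combination (2 * ψ (update x t 0)) * hs
        | linear_combination (2 * ψ (update x t 1)) * hs

theorem HasPull.hasDiag_toggle {k : ℕ} {t : ι} {p : (ι → Fin 2) → Prop}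
    [DecidablePred p] (hp : ∀ x b, p (update x t b) ↔ p x)
    (h : HasPull k (toggle t p)) : HasDiag k fun x => if p x ∧ x t = 1 then -1 else 1 := by
  obtain ⟨C, hC, hCψ⟩ := h
  obtain ⟨g, s, hg, hs, hgψ⟩ := exists_hadamard t
  refine ⟨[g] ++ (C ++ [g]), ?_, fun ψ x => ?_⟩
  · rw [Circuit.cnotCount_append, Circuit.cnotCount_append]
    simpa [Circuit.cnotCount, hg] using hC
  · rw [Circuit.append_mulVec, Circuit.append_mulVec, Circuit.singleton_mulVec,
      Circuit.singleton_mulVec, hgψ, hCψ, hCψ, hgψ, hgψ, toggle, toggle]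
    conv_rhs => rw [← update_eq_self t x]
    simp only [hp, update_self, update_idem]
    generalize x t = b
    by_cases hpx : p x <;> fin_cases b <;> simp [hpx] <;>
      first
        | linear_combination (2 * ψ (update x t 0)) * hs
        | linear_combination (2 * ψ (update x t 1)) * hs
        | linear_combination (-2 * ψ (update x t 1)) * hs

theorem exists_eighth_root : ∃ w : Circle, (w : ℂ) ^ 4 = -1 := by
  refine ⟨Circle.exp (Real.pi / 4), ?_⟩
  rw [Circle.coe_exp, ← Complex.exp_nat_mul]
  have : ((4 : ℕ) : ℂ) * (((Real.pi / 4 : ℝ) : ℂ) * Complex.I) = Real.pi * Complex.I := by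
    push_cast
    ring
  rw [this, Complex.exp_pi_mul_I]

/-- The doubly controlled `Z` gate from phases of parities. -/
theorem hasDiag_ccz {a b c : ι} (hab : a ≠ b) (hac : a ≠ c) (hbc : b ≠ c) :
    HasDiag 10 fun x => if (x a = 1 ∧ x b = 1) ∧ x c = 1 then -1 else 1 := by
  obtain ⟨w, hw⟩ := exists_eighth_root
  have hinv : ∀ u v : Fin 2, u + v + v = u := by decide
  have hinv' : ∀ u v v' : Fin 2, u + v + v' + v + v' = u := by decide
  have pair : ∀ {a b : ι}, a ≠ b →
      HasDiag 2 fun x => if x b + x a = 1 then ((w⁻¹ : Circle) : ℂ) else 1 := by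
    intro a b hab
    have := (hasDiag_phase b w⁻¹).conj (hasPull_cnot hab) fun x => by
      simp [update_of_ne hab, hinv]
    simpa using this
  have triple : HasDiag 4 fun x => if x c + x a + x b = 1 then (w : ℂ) else 1 := by
    have := (hasDiag_phase c w).conj ((hasPull_cnot hbc).comp (hasPull_cnot hac)) fun x => by
      simp [update_of_ne hac, update_of_ne hbc, hinv']
    simpa [update_of_ne hac, update_of_ne hbc] using this
  -- In the exponent of `w`, with `w ^ 4 = -1`, this is `4abc = a + b + c - (a ⊕ b) - (b ⊕ c) - (a ⊕
  -- c) + (a ⊕ b ⊕ c)`. The pair parities cost two C-NOTs each and the triple parity four.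
  have := ((((((hasDiag_phase a w).mul (hasDiag_phase b w)).mul (hasDiag_phase c w)).mul
    (pair hab)).mul (pair hbc)).mul (pair hac)).mul triple
  convert this using 2 with x
  have hw0 : (w : ℂ) ≠ 0 := w.coe_ne_zero
  generalize x a = u
  generalize x b = v
  generalize x c = t
  fin_cases u <;> fin_cases v <;> fin_cases t <;> simp [hw0]
  field_simp
  exact hw.symm

theorem hasPull_toffoli {a b c : ι} (hab : a ≠ b) (hac : a ≠ c) (hbc : b ≠ c) :
    HasPull 10 (toggle c fun x => x a = 1 ∧ x b = 1) :=
  (hasDiag_ccz hab hac hbc).hasPull_toggle fun x s => by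
    simp [update_of_ne hac, update_of_ne hbc]

/-- A ladder of Toffoli gates adds to every target `q j` the conjunction of the controls
`a 0, …, a j`. -/
theorem exists_ladder (a q : ℕ → ι) (k : ℕ) (haq : ∀ i ≤ k, ∀ j ≤ k, a i ≠ q j)
    (hq : ∀ i ≤ k, ∀ j ≤ k, q i = q j → i = j) :
    ∃ f : (ι → Fin 2) → ι → Fin 2, HasPull (20 * k + 1) f ∧
      (∀ x, ∀ j ≤ k, f x (q j) = x (q j) + if ∀ l ≤ j, x (a l) = 1 then 1 else 0) ∧
      ∀ x i, (∀ j ≤ k, i ≠ q j) → f x i = x i := by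
  induction k with
  | zero =>
    refine ⟨_, hasPull_cnot (haq 0 le_rfl 0 le_rfl), fun x j hj => ?_, fun x i hi => ?_⟩
    · obtain rfl : j = 0 := by omega
      simp only [update_self, Nat.le_zero_eq, forall_eq]
      congr 1
      generalize x (a 0) = u
      revert u
      decide
    · rw [update_of_ne (hi 0 le_rfl)]
  | succ k ih =>
    obtain ⟨f, hf, hfq, hfi⟩ := ih (fun i hi j hj => haq i (by omega) j (by omega))
      fun i hi j hj => hq i (by omega) j (by omega)
    have hqq : ∀ j ≤ k, q (k + 1) ≠ q j := fun j hj h => by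
      have := hq (k + 1) le_rfl j (by omega) h
      omega
    have hT := hasPull_toffoli (haq (k + 1) le_rfl k (by omega))
      (haq (k + 1) le_rfl (k + 1) le_rfl) (hqq k le_rfl).symm
    set T := toggle (q (k + 1)) fun x => x (a (k + 1)) = 1 ∧ x (q k) = 1 with hTdef
    have hTne : ∀ x i, i ≠ q (k + 1) → T x i = x i := fun x i hi => update_of_ne hi _ _
    have hTeq : ∀ x, T x (q (k + 1)) =
        x (q (k + 1)) + if x (a (k + 1)) = 1 ∧ x (q k) = 1 then 1 else 0 := fun x => by
      simp only [hTdef, toggle, update_self]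
    have hTa : ∀ x, ∀ l ≤ k + 1, T x (a l) = x (a l) := fun x l hl =>
      hTne x _ (haq l hl (k + 1) le_rfl)
    -- The last target receives `a (k + 1)` times the value of `q k` both before and after `f`
    -- changes it. The unknown initial value cancels and the conjunction remains.
    refine ⟨T ∘ f ∘ T, ((hT.comp (hf.comp hT))).mono (by omega), fun x j hj => ?_,
      fun x i hi => ?_⟩
    · rcases Nat.lt_or_ge k j with hkj | hkj
      · obtain rfl : j = k + 1 := by omega
        simp only [Function.comp_apply]
        rw [hTeq, hfi _ _ hqq, hTeq, hfi _ _ fun j hj => haq (k + 1) le_rfl j (by omega),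
          hfq _ k le_rfl, hTa _ _ le_rfl, hTne _ _ (hqq k le_rfl).symm]
        have h1 : (∀ l ≤ k, T x (a l) = 1) ↔ ∀ l ≤ k, x (a l) = 1 :=
          forall₂_congr fun l hl => by rw [hTa x l (by omega)]
        have h2 : (∀ l ≤ k + 1, x (a l) = 1) ↔ (∀ l ≤ k, x (a l) = 1) ∧ x (a (k + 1)) = 1 := by
          refine ⟨fun h => ⟨fun l hl => h l (by omega), h _ le_rfl⟩, fun h l hl => ?_⟩
          rcases Nat.lt_or_ge k l with h' | h'
          · obtain rfl : l = k + 1 := by omega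
            exact h.2
          · exact h.1 l h'
        rw [if_congr h1 rfl rfl, if_congr h2 rfl rfl]
        generalize x (a (k + 1)) = u
        generalize x (q k) = v
        generalize x (q (k + 1)) = s
        by_cases hall : ∀ l ≤ k, x (a l) = 1
        · rw [if_pos hall, if_congr (and_iff_right hall) rfl rfl]
          revert u v s
          decide
        · rw [if_neg hall, if_neg (fun h => hall h.1 : ¬((∀ l ≤ k, x (a l) = 1) ∧ u = 1))]
          revert u v s
          decide
      · simp only [Function.comp_apply]
        rw [hTne _ _ (hqq j hkj).symm, hfq _ j hkj, hTne _ _ (hqq j hkj).symm]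
        have h1 : (∀ l ≤ j, T x (a l) = 1) ↔ ∀ l ≤ j, x (a l) = 1 :=
          forall₂_congr fun l hl => by rw [hTa x l (by omega)]
        rw [if_congr h1 rfl rfl]
    · simp only [Function.comp_apply]
      rw [hTne _ _ (hi _ le_rfl), hfi _ _ fun j hj => hi j (by omega), hTne _ _ (hi _ le_rfl)]

/-- A multi-controlled not with as many unused qubits as controls. -/
theorem hasPull_mcx (a q : ℕ → ι) (k : ℕ) (haq : ∀ i ≤ k, ∀ j ≤ k, a i ≠ q j)
    (hq : ∀ i ≤ k, ∀ j ≤ k, q i = q j → i = j) :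
    HasPull (40 * k + 2) (toggle (q k) fun x => ∀ l ≤ k, x (a l) = 1) := by
  obtain ⟨f, hf, hfq, hfi⟩ := exists_ladder a q k haq hq
  rcases k with _ | k
  · convert hf.mono (show 20 * 0 + 1 ≤ 40 * 0 + 2 by omega) using 1
    funext x i
    rw [toggle]
    by_cases hi : i = q 0
    · subst hi
      rw [update_self, hfq x 0 le_rfl]
    · rw [update_of_ne hi, hfi x i]
      intro j hj
      obtain rfl : j = 0 := by omega
      exact hi
  -- The shorter ladder restores every target except the last.
  · obtain ⟨g, hg, hgq, hgi⟩ := exists_ladder a q k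
      (fun i hi j hj => haq i (by omega) j (by omega))
      fun i hi j hj => hq i (by omega) j (by omega)
    convert (hf.comp hg).mono (show 20 * (k + 1) + 1 + (20 * k + 1) ≤ 40 * (k + 1) + 2 by omega)
      using 1
    funext x i
    have hga : ∀ l ≤ k + 1, g x (a l) = x (a l) := fun l hl =>
      hgi x _ fun j hj => haq l hl j (by omega)
    have hgk : g x (q (k + 1)) = x (q (k + 1)) := hgi x _ fun j hj h => by
      have := hq (k + 1) le_rfl j (by omega) h
      omega
    have h1 : ∀ j ≤ k + 1, (∀ l ≤ j, g x (a l) = 1) ↔ ∀ l ≤ j, x (a l) = 1 := fun j hj =>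
      forall₂_congr fun l hl => by rw [hga l (by omega)]
    rw [toggle, Function.comp_apply]
    by_cases hi : i = q (k + 1)
    · subst hi
      rw [update_self, hfq _ _ le_rfl, hgk, if_congr (h1 _ le_rfl) rfl rfl]
    · rw [update_of_ne hi]
      by_cases hj : ∃ j ≤ k, i = q j
      · obtain ⟨j, hj, rfl⟩ := hj
        rw [hfq _ j (by omega), hgq _ j hj, if_congr (h1 j (by omega)) rfl rfl]
        generalize (if ∀ l ≤ j, x (a l) = 1 then (1 : Fin 2) else 0) = u
        generalize x (q j) = v
        revert u v
        decide
      · push Not at hj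
        rw [hfi, hgi x i hj]
        intro j hjk
        rcases Nat.lt_or_ge k j with h | h
        · obtain rfl : j = k + 1 := by omega
          exact hi
        · exact hj j h

/-- A group commutator: `d` is flipped twice and restored, while `t` is flipped, under `r`, by two
values of `d` that differ exactly when `p` holds. -/
theorem toggle_commutator {t d : ι} (htd : t ≠ d) {p r : (ι → Fin 2) → Prop}
    [DecidablePred p] [DecidablePred r] (hpt : ∀ x b, p (update x t b) ↔ p x) (hpd : ∀ x b, p (update x d b) ↔ p x)
    (hrt : ∀ x b, r (update x t b) ↔ r x) (hrd : ∀ x b, r (update x d b) ↔ r x) :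
    toggle d p ∘ toggle t (fun x => r x ∧ x d = 1) ∘ toggle d p ∘
      toggle t (fun x => r x ∧ x d = 1) = toggle t fun x => p x ∧ r x := by
  funext x i
  simp only [Function.comp_apply, toggle, hpt, hpd, hrt, hrd, update_self, update_of_ne htd.symm]
  have h2 : ∀ u v : Fin 2, u + v + v = u := by decide
  by_cases hid : i = d
  · subst hid
    simp [update_of_ne htd.symm, h2]
  · by_cases hit : i = t
    · subst hit
      simp only [update_self, update_of_ne hid]
      have h3 : ∀ u v : Fin 2, u + (if v = 1 then 1 else 0) + (if v = 0 then 1 else 0) =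
          u + 1 := by decide
      have h4 : ∀ u v : Fin 2, u + (if v = 1 then 1 else 0) + (if v = 1 then 1 else 0) = u := by
        decide
      by_cases hp : p x <;> by_cases hr : r x <;> simp [hp, hr, h3, h4]
    · simp [update_of_ne hid, update_of_ne hit]

/-- A multi-controlled not on `n` qubits with one unused qubit. -/
theorem hasPull_mcx_one_dirty (e : ℕ → ι) {n : ℕ} (hn : 2 ≤ n)
    (he : ∀ i ≤ n, ∀ j ≤ n, e i = e j → i = j) :
    HasPull (80 * n) (toggle (e (n - 1)) fun x => ∀ l < n - 1, x (e l) = 1) := by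
  -- Balanced halves: while one half of the controls is being tested, the other half supplies enough
  -- borrowed qubits.
  obtain ⟨h, hh1, hh2, hh3⟩ : ∃ h, 1 ≤ h ∧ 2 * h ≤ n ∧ n ≤ 2 * h + 1 := ⟨n / 2, by omega⟩
  have hne : ∀ i ≤ n, ∀ j ≤ n, i ≠ j → e i ≠ e j := fun i hi j hj hij h => hij (he i hi j hj h)
  obtain ⟨k, hk⟩ : ∃ k, h + k = n - 1 := ⟨n - 1 - h, by omega⟩
  -- The first `h` controls act on the unused qubit `e n`, borrowing qubits from `e h` on.
  have hA := hasPull_mcx (fun i => e i) (fun j => e (if j < h - 1 then h + j else n)) (h - 1)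
    (fun i hi j hj => by
      split_ifs
      · exact hne _ (by omega) _ (by omega) (by omega)
      · exact hne _ (by omega) _ (by omega) (by omega))
    (fun i hi j hj hij => by
      have := he _ (by split_ifs <;> omega) _ (by split_ifs <;> omega) hij
      split_ifs at this <;> omega)
  -- The other `k` controls together with `e n` act on the true target, borrowing the first `k`
  -- qubits.
  have hB := hasPull_mcx (fun i => e (if i < k then h + i else n))
    (fun j => e (if j < k then j else n - 1)) k
    (fun i hi j hj => hne _ (by split_ifs <;> omega) _ (by split_ifs <;> omega)
      (by split_ifs <;> omega))
    (fun i hi j hj hij => by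
      have := he _ (by split_ifs <;> omega) _ (by split_ifs <;> omega) hij
      split_ifs at this <;> omega)
  simp only [lt_irrefl, if_false] at hA hB
  have hBpred : ∀ x : ι → Fin 2, (∀ l ≤ k, x (e (if l < k then h + l else n)) = 1) ↔
      (∀ l < k, x (e (h + l)) = 1) ∧ x (e n) = 1 := by
    intro x
    refine ⟨fun H => ⟨fun l hl => ?_, ?_⟩, fun H l hl => ?_⟩
    · simpa [hl] using H l hl.le
    · simpa using H k le_rfl
    · split_ifs with hlk
      · exact H.1 l hlk
      · exact H.2
  rw [toggle_congr _ hBpred] at hB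
  have hAB := hA.comp (hB.comp (hA.comp hB))
  rw [toggle_commutator (hne _ (by omega) _ le_rfl (by omega))] at hAB
  · have hpred : ∀ x : ι → Fin 2, ((∀ l ≤ h - 1, x (e l) = 1) ∧ ∀ l < k, x (e (h + l)) = 1) ↔
        ∀ l < n - 1, x (e l) = 1 := by
      intro x
      refine ⟨fun H l hl => ?_, fun H => ⟨fun l hl => H l (by omega),
        fun l hl => H _ (by omega)⟩⟩
      rcases Nat.lt_or_ge l h with hlh | hlh
      · exact H.1 l (by omega)
      · have := H.2 (l - h) (by omega)
        rwa [Nat.add_sub_cancel' hlh] at this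
    rw [toggle_congr _ hpred] at hAB
    exact hAB.mono (by omega)
  · exact fun x b => forall₂_congr fun l hl => by
      rw [update_of_ne (hne _ (by omega) _ (by omega) (by omega))]
  · exact fun x b => forall₂_congr fun l hl => by
      rw [update_of_ne (hne _ (by omega) _ (by omega) (by omega))]
  · exact fun x b => forall₂_congr fun l hl => by
      rw [update_of_ne (hne _ (by omega) _ (by omega) (by omega))]
  · exact fun x b => forall₂_congr fun l hl => by
      rw [update_of_ne (hne _ (by omega) _ (by omega) (by omega))]

/-- Without data qubits this is a global sign, with one a phase gate; otherwise the multi-controlled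
not is turned into a sign, the dirty ancilla being the unused qubit. -/
theorem hasDiag_mcz (n : ℕ) : HasDiag (80 * n) fun x : Register n 0 1 → Fin 2 =>
    if ∀ l, x (Sum.inl l) = 1 then -1 else 1 := by
  rcases n with _ | _ | n
  · refine ⟨[Gate.phase (Circle.exp Real.pi)], by simp [Circuit.cnotCount, Gate.isCnot],
      fun ψ x => ?_⟩
    rw [Circuit.singleton_mulVec, Gate.phase_mulVec]
    simp [Circle.coe_exp, Complex.exp_pi_mul_I]
  · convert (hasDiag_phase (Sum.inl 0 : Register 1 0 1) (Circle.exp Real.pi)).mono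
      (show 0 ≤ 80 * (0 + 1) by omega) using 2 with x
    simp [Circle.coe_exp, Complex.exp_pi_mul_I, Fin.forall_fin_one]
  · let e : ℕ → Register (n + 2) 0 1 := fun i =>
      if h : i < n + 2 then Sum.inl ⟨i, h⟩ else Sum.inr (Sum.inr 0)
    have he : ∀ i ≤ n + 2, ∀ j ≤ n + 2, e i = e j → i = j := by
      intro i hi j hj hij
      simp only [e] at hij
      split_ifs at hij with h1 h2 h2
      · exact congrArg Fin.val (Sum.inl_injective hij)
      · omega
    have hp := (hasPull_mcx_one_dirty e (by omega) he).hasDiag_toggle fun x b =>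
      forall₂_congr fun l hl => by
        rw [update_of_ne]
        intro h
        have := he _ (by omega) _ (by omega) h
        omega
    convert hp using 2 with x
    refine if_congr ⟨fun H => ⟨fun l hl => ?_, ?_⟩, fun H l => ?_⟩ rfl rfl
    · have : l < n + 2 := by omega
      simp only [e, this, dif_pos]
      exact H _
    · simp only [e, show n + 2 - 1 < n + 2 by omega, dif_pos]
      exact H _
    · have hel : e l = Sum.inl l := by simp [e]
      rw [← hel]
      rcases Nat.lt_or_ge (l : ℕ) (n + 2 - 1) with h | h
      · exact H.1 l h
      · have : (l : ℕ) = n + 2 - 1 := by omega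
        rw [this]
        exact H.2

/-- Flipping the data qubits, but not the ancilla, moves the sign from the all-ones state to the
all-zeros state. -/
theorem costH0_le (n : ℕ) : costH0 0 1 n ≤ (80 * n : ℕ) := by
  have hsum : ∀ u : Fin 2, u + 1 + 1 = u := by decide
  obtain ⟨C, hC, hCψ⟩ := (hasDiag_mcz n).conj (hasPull_add fun i => Sum.elim (fun _ => 1)
    (fun _ => 0) i) fun x => by
      funext i
      rcases i with i | i <;> simp [hsum]
  have himp : Implements 0 1 C (householder (ketZero n)) := by
    rw [implements_square_iff]
    intro b
    apply Matrix.ext_of_mulVec_single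
    intro y
    simp only [← Matrix.mulVec_mulVec]
    generalize (Pi.single y 1 : Fin (2 ^ n) → ℂ) = φ
    funext X
    rw [hCψ, dataEmb_mulVec, dataEmb_mulVec, householder_mulVec]
    have hb : ∀ u : Fin 2, u + 1 = 1 ↔ u = 0 := by decide
    have hz : (∀ l : Fin n, X (Sum.inl l) = 0) ↔ (bits n).symm (fun k => X (Sum.inl k)) = 0 := by
      rw [Equiv.symm_apply_eq]
      have h0 : bits n 0 = fun _ => 0 := by
        funext i
        apply Fin.ext
        simp [bits_val]
      rw [h0, funext_iff]
    simp only [Pi.add_apply, Sum.elim_inl, hb, hz]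
    generalize (bits n).symm (fun k => X (Sum.inl k)) = x
    by_cases h1 : x = 0
    · subst h1
      simp [ketZero]
      ring_nf
    · simp [ketZero, h1]
  refine (cnotCost_le himp).trans ?_
  exact_mod_cast hC

end Classical

/-! ### Multiplexed gates and the disentangling of states. -/

section Disentangling

variable {ι : Type} [Fintype ι] [DecidableEq ι]

/-- The circuit acts on the qubit `t` by the unitary `G x`, which depends only on the qubits
in `S`. -/
structure IsMultiplexed (C : Circuit ι) (t : ι) (S : Finset ι)
    (G : (ι → Fin 2) → Matrix (Fin 2) (Fin 2) ℂ) : Prop where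
  isometry : ∀ x, (G x)ᴴ * G x = 1
  congr : ∀ x y, (∀ i ∈ S, x i = y i) → G x = G y
  mulVec : ∀ ψ x, (C.mat *ᵥ ψ) x = ∑ b, G x (x t) b * ψ (update x t b)

theorem exists_unitary_clearing {v : Fin 2 → ℂ} (hv : v ≠ 0) :
    ∃ U : Matrix.unitaryGroup (Fin 2) ℂ, ((U : Matrix (Fin 2) (Fin 2) ℂ) *ᵥ v) 1 = 0 := by
  obtain ⟨s, hs, -, hunit⟩ := exists_normalize hv
  set u := (s : ℂ)⁻¹ • v with hu
  have hs' : (s : ℂ) ≠ 0 := by exact_mod_cast hs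
  have hvu : v = (s : ℂ) • u := by rw [hu, smul_smul, mul_inv_cancel₀ hs', one_smul]
  simp only [dotProduct, Fin.sum_univ_two, Pi.star_apply, RCLike.star_def] at hunit
  refine ⟨⟨!![star (u 0), star (u 1); -u 1, u 0], ?_⟩, ?_⟩
  · rw [Matrix.mem_unitaryGroup_iff]
    ext i j
    fin_cases i <;> fin_cases j <;> simp [Matrix.mul_apply] <;>
      first
        | linear_combination hunit
        | ring
  · rw [hvu]
    simp [Matrix.mulVec, dotProduct, Fin.sum_univ_two]
    ring

theorem hasDiag_cz {a t : ι} (h : a ≠ t) :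
    HasDiag 1 fun x => if x a = 1 ∧ x t = 1 then -1 else 1 := by
  refine HasPull.hasDiag_toggle (fun x b => by rw [update_of_ne h]) ?_
  convert hasPull_cnot h using 1
  funext x
  rw [toggle]
  congr 2
  generalize x a = u
  revert u
  decide

theorem mulVec_ne_zero_of_isometry {U : Matrix (Fin 2) (Fin 2) ℂ} (hU : Uᴴ * U = 1)
    {v : Fin 2 → ℂ} (hv : v ≠ 0) : U *ᵥ v ≠ 0 := by
  intro h
  apply hv
  rw [← Matrix.one_mulVec v, ← hU, ← Matrix.mulVec_mulVec, h, Matrix.mulVec_zero]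

/-- A multiplexed gate, up to a diagonal gate, that maps given states of the target qubit to
multiples of `|0⟩`. -/
theorem exists_multiplexed (t : ι) (S : Finset ι) (ht : t ∉ S) (w : (ι → Fin 2) → Fin 2 → ℂ)
    (hw : ∀ x y, (∀ i ∈ S, x i = y i) → w x = w y) (hw₀ : ∀ x, w x ≠ 0) :
    ∃ C G, IsMultiplexed C t S G ∧ C.cnotCount + 1 ≤ 2 ^ S.card ∧ ∀ x, (G x *ᵥ w x) 1 = 0 := by
  induction S using Finset.induction_on generalizing w with
  | empty =>
    obtain ⟨U, hU⟩ := exists_unitary_clearing (hw₀ 0)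
    refine ⟨[Gate.single t U], fun _ => U, ⟨fun x => Matrix.mem_unitaryGroup_iff'.mp U.2,
      fun _ _ _ => rfl, fun ψ x => ?_⟩, by simp [Circuit.cnotCount, Gate.isCnot], fun x => ?_⟩
    · rw [Circuit.singleton_mulVec, Gate.single_mulVec]
    · rw [hw x 0 (by simp), hU]
  | insert a S ha ih =>
    have htS : t ∉ S := fun h => ht (Finset.mem_insert_of_mem h)
    have hat : a ≠ t := fun h => ht (h ▸ Finset.mem_insert_self a S)
    have hupd : ∀ x y : ι → Fin 2, (∀ i ∈ S, x i = y i) → ∀ b,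
        w (update x a b) = w (update y a b) := by
      intro x y hxy b
      refine hw _ _ fun i hi => ?_
      by_cases hia : i = a
      · subst hia; simp
      · simp [hia, hxy i (Finset.mem_of_mem_insert_of_ne hi hia)]
    -- A choice made as a function of the two states alone keeps the reflection vector dependent
    -- only on the qubits in `S`.
    have hF : ∀ w₀ w₁ : Fin 2 → ℂ, ∃ v : Fin 2 → ℂ, w₀ ≠ 0 → star v ⬝ᵥ v = 1 ∧
        ∃ c : ℂ, w₁ - (2 * (star v ⬝ᵥ w₁)) • v = c • w₀ := by
      intro w₀ w₁
      by_cases h : w₀ = 0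
      · exact ⟨0, fun h' => absurd h h'⟩
      · obtain ⟨v, hv, -, hc⟩ := exists_reflection w₀ w₁ h
        exact ⟨v, fun _ => ⟨hv, hc⟩⟩
    choose F hF using hF
    set n : (ι → Fin 2) → Fin 2 → ℂ := fun x => F (w (update x a 0)) (w (update x a 1)) with hn
    obtain ⟨C', G', hG', hC', hGn⟩ := ih htS n
      (fun x y hxy => by simp only [hn, hupd x y hxy])
      (fun x h => by
        have := (hF _ (w (update x a 1)) (hw₀ (update x a 0))).1
        rw [show F _ _ = 0 from h] at this
        simp at this)
    obtain ⟨C'', G'', hG'', hC'', hGw⟩ := ih htS (fun x => G' x *ᵥ w (update x a 0))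
      (fun x y hxy => by rw [hG'.congr x y hxy, hupd x y hxy])
      (fun x => mulVec_ne_zero_of_isometry (hG'.isometry x) (hw₀ _))
    obtain ⟨D, hD, hDψ⟩ := hasDiag_cz hat
    let Z : (ι → Fin 2) → Matrix (Fin 2) (Fin 2) ℂ := fun x =>
      Matrix.diagonal fun b => if x a = 1 ∧ b = 1 then -1 else 1
    -- Since `G'` maps `n` to a multiple of `|0⟩`, it conjugates the reflection along `n` into `-Z`.
    -- After the controlled `Z` the states for `a = 0` and `a = 1` are therefore parallel, and `C''`
    -- clears both without looking at `a`. The count is `2 * (2 ^ k - 1) + 1 = 2 ^ (k + 1) - 1`,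
    -- where `k` is the size of `S`.
    refine ⟨C' ++ (D ++ C''), fun x => G'' x * (Z x * G' x), ⟨fun x => ?_, fun x y hxy => ?_,
      fun ψ x => ?_⟩, ?_, fun x => ?_⟩
    · refine isometry_mul (hG''.isometry x) (isometry_mul ?_ (hG'.isometry x))
      simp only [Z, Matrix.diagonal_conjTranspose, Matrix.diagonal_mul_diagonal]
      rw [← Matrix.diagonal_one]
      congr 1
      funext b
      simp only [Pi.star_apply]
      split_ifs <;> simp
    · have hS : ∀ i ∈ S, x i = y i := fun i hi => hxy i (Finset.mem_insert_of_mem hi)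
      simp only [Z, hG''.congr x y hS, hG'.congr x y hS, hxy a (Finset.mem_insert_self a S)]
    · have hins : ∀ b, G' (update x t b) = G' x := fun b => hG'.congr _ _ fun i hi => by
        rw [update_of_ne]
        rintro rfl
        exact htS hi
      rw [Circuit.append_mulVec, Circuit.append_mulVec, hG''.mulVec]
      simp only [hDψ, hG'.mulVec, hins, update_self, update_idem, update_of_ne hat]
      simp only [Z, Matrix.mul_apply (M := G'' x), Matrix.diagonal_mul, Finset.sum_mul]
      rw [Finset.sum_comm]
      refine Finset.sum_congr rfl fun b _ => ?_
      rw [Finset.mul_sum, Finset.mul_sum]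
      exact Finset.sum_congr rfl fun b' _ => by ring
    · rw [Circuit.cnotCount_append, Circuit.cnotCount_append, Finset.card_insert_of_notMem ha,
        pow_succ]
      omega
    · simp only [← Matrix.mulVec_mulVec]
      by_cases hxa : x a = 1
      · have hwx : w x = w (update x a 1) := by rw [← hxa, update_eq_self]
        obtain ⟨hunit, c, hc⟩ := hF _ (w (update x a 1)) (hw₀ (update x a 0))
        change star (n x) ⬝ᵥ n x = 1 at hunit
        change w (update x a 1) - (2 * (star (n x) ⬝ᵥ _)) • n x = _ at hc
        rw [← hwx] at hc
        have hc' := congrArg (G' x *ᵥ ·) hc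
        simp only [Matrix.mulVec_sub, Matrix.mulVec_smul] at hc'
        rw [← star_dotProduct_mulVec (hG'.isometry x)] at hunit hc'
        have hp := hGn x
        generalize G' x *ᵥ n x = p at *
        have hZ : Z x *ᵥ (G' x *ᵥ w x) = (-c) • (G' x *ᵥ w (update x a 0)) := by
          rw [neg_smul, ← hc']
          generalize G' x *ᵥ w x = y
          simp only [dotProduct, Fin.sum_univ_two, hp, mul_zero, add_zero, Pi.star_apply,
            RCLike.star_def] at hunit ⊢
          funext b
          fin_cases b
          · simp [Z, Matrix.mulVec_diagonal]
            linear_combination -2 * y 0 * hunit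
          · simp [Z, Matrix.mulVec_diagonal, hxa, hp]
        rw [hZ, Matrix.mulVec_smul, Pi.smul_apply, hGw, smul_zero]
      · have hxa0 : x a = 0 := by
          revert hxa
          generalize x a = u
          revert u
          decide
        have hwx : w x = w (update x a 0) := by rw [← hxa0, update_eq_self]
        have hZ : Z x = 1 := by simp [Z, hxa]
        rw [hZ, Matrix.one_mulVec, hwx]
        exact hGw x

/-- Any state of the qubits in `S` can be mapped to a multiple of `|0⟩`. -/
theorem exists_circuit_unprepare (S : Finset ι) (ψ : (ι → Fin 2) → ℂ)
    (hψ : ∀ x, (∃ i, i ∉ S ∧ x i ≠ 0) → ψ x = 0) :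
    ∃ C : Circuit ι, C.cnotCount + 1 ≤ 2 ^ S.card ∧
      ∃ c : ℂ, C.mat *ᵥ ψ = c • Pi.single 0 1 := by
  induction S using Finset.induction_on generalizing ψ with
  | empty =>
    refine ⟨[], by simp [Circuit.cnotCount], ψ 0, ?_⟩
    rw [Circuit.mat_nil, Matrix.one_mulVec]
    funext x
    by_cases hx : x = 0
    · subst hx; simp
    · obtain ⟨i, hi⟩ := Function.ne_iff.mp hx
      rw [hψ x ⟨i, by simp, hi⟩]
      simp [hx]
  | insert t S ht ih =>
    let v : (ι → Fin 2) → Fin 2 → ℂ := fun x b =>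
      ψ fun i => if i = t then b else if i ∈ S then x i else 0
    have hv : ∀ x y, (∀ i ∈ S, x i = y i) → v x = v y := by
      intro x y hxy
      funext b
      simp only [v]
      congr 1
      funext i
      split_ifs with h1 h2
      · rfl
      · exact hxy i h2
      · rfl
    -- Where the conditional state vanishes there is nothing to clear; an arbitrary nonzero state
    -- stands in.
    obtain ⟨C, G, hG, hC, hGv⟩ := exists_multiplexed t S ht
      (fun x => if v x = 0 then Pi.single 0 1 else v x)
      (fun x y hxy => by simp only [hv x y hxy]) (fun x => by
        split_ifs with h
        · simp
        · exact h)
    have hGv' : ∀ x, (G x *ᵥ v x) 1 = 0 := by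
      intro x
      by_cases h : v x = 0
      · simp [h]
      · simpa [h] using hGv x
    obtain ⟨D, hD, c, hc⟩ := ih (C.mat *ᵥ ψ) (by
      rintro x ⟨i, hiS, hi⟩
      rw [hG.mulVec]
      by_cases hout : ∃ j, j ∉ insert t S ∧ x j ≠ 0
      · obtain ⟨j, hj, hxj⟩ := hout
        refine Finset.sum_eq_zero fun b _ => ?_
        rw [hψ _ ⟨j, hj, ?_⟩, mul_zero]
        rwa [update_of_ne]
        rintro rfl
        exact hj (Finset.mem_insert_self _ _)
      · push Not at hout
        have hxt : x t = 1 := by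
          have hit : i = t := by
            by_contra hit
            exact hi (hout i (by simp [hit, hiS]))
          subst hit
          revert hi
          generalize x i = u
          revert u
          decide
        rw [hxt]
        have hsum : (G x *ᵥ v x) 1 = ∑ b, G x 1 b * v x b := rfl
        refine Eq.trans ?_ (hsum.symm.trans (hGv' x))
        refine Finset.sum_congr rfl fun b _ => ?_
        simp only [v]
        congr 2
        funext j
        by_cases hj : j = t
        · subst hj; simp
        · rw [update_of_ne hj, if_neg hj]
          split_ifs with hjS
          · rfl
          · exact hout j (by simp [hj, hjS]))
    refine ⟨C ++ D, ?_, c, ?_⟩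
    · rw [Circuit.cnotCount_append, Finset.card_insert_of_notMem ht, pow_succ]
      omega
    · rw [Circuit.append_mulVec, hc]

/-- Copies of the qubit `k` are added to the qubits in `J`. -/
theorem hasPull_fanout (k : ι) (J : Finset ι) (hk : k ∉ J) :
    HasPull J.card fun x i => if i ∈ J then x i + x k else x i := by
  induction J using Finset.induction_on with
  | empty => exact ⟨[], by simp [Circuit.cnotCount], fun ψ x => by simp [Circuit.mat]⟩
  | insert a J ha ih =>
    have hka : k ≠ a := fun h => hk (h ▸ Finset.mem_insert_self a J)
    have hkJ : k ∉ J := fun h => hk (Finset.mem_insert_of_mem h)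
    convert (ih hkJ).comp (hasPull_cnot hka) using 1
    · rw [Finset.card_insert_of_notMem ha]
    · funext x i
      by_cases hi : i = a
      · subst hi; simp [ha]
      · simp [hi, update_of_ne hka]

end Disentangling

/-! ### Cost of reflections along states in a block or on two basis states. -/

section ReflectionCost

variable {n c d : ℕ}

theorem bits_zero : bits n 0 = 0 := by
  funext i
  apply Fin.ext
  simp [bits_val]

/-- Disentangling up to a phase suffices, because a reflection does not see the phase of its vector.
The circuit is used once forwards and once backwards. -/
theorem cnotCost_householder_of_unprepare {v : Fin (2 ^ n) → ℂ} (hv : star v ⬝ᵥ v = 1)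
    {C : Circuit (Fin n)} {a : ℂ}
    (hC : (C.mat *ᵥ fun u => v ((bits n).symm u)) = a • Pi.single 0 1) :
    cnotCost c d (householder v) ≤ (2 * C.cnotCount : ℕ) + costH0 c d n := by
  have hU := C.dataMat_isometry
  have hUv : C.dataMat *ᵥ v = a • ketZero n := by
    funext x
    rw [Circuit.dataMat_mulVec, hC]
    have : bits n x = 0 ↔ x = 0 := by
      rw [← bits_zero, (bits n).injective.eq_iff]
    simp [ketZero, Pi.single_apply, this]
  have ha : star a * a = 1 := by
    have := star_dotProduct_mulVec hU v v
    rw [hUv, hv, star_smul, smul_dotProduct, dotProduct_smul, dotProduct_ketZero] at this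
    simpa using this
  have hv' : v = a • (C.dataMatᴴ *ᵥ ketZero n) := by
    rw [← Matrix.mulVec_smul, ← hUv, Matrix.mulVec_mulVec, hU, Matrix.one_mulVec]
  have hU' : C.dataMatᴴᴴ * C.dataMatᴴ = 1 := by
    rw [Matrix.conjTranspose_conjTranspose]
    exact mul_eq_one_comm.mp hU
  rw [hv', householder_smul ha]
  refine (cnotCost_householder_mulVec_le hU' _).trans ?_
  have := (cnotCost_conjTranspose_le (c := c) (d := d) hU).trans (cnotCost_dataMat_le C)
  rw [costH0]
  push_cast
  gcongr

/-- The reflection along a state that is supported on the basis states with given upper bits. -/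
theorem cnotCost_householder_block {a : ℕ} {v : Fin (2 ^ n) → ℂ} (hv : star v ⬝ᵥ v = 1)
    (x₀ : Fin n → Fin 2)
    (hvs : ∀ x, v x ≠ 0 → ∀ i : Fin n, a ≤ i → bits n x i = x₀ i) :
    cnotCost 0 1 (householder v) ≤ (2 * (2 ^ a - 1) + 80 * n : ℕ) := by
  -- Flipping the prescribed upper bits moves the block to the states of the `a` lower qubits.
  let u : Fin n → Fin 2 := fun i => if a ≤ i then x₀ i else 0
  obtain ⟨C, hC, hCψ⟩ := hasPull_add u
  let S : Finset (Fin n) := Finset.univ.filter fun i => (i : ℕ) < a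
  have hS : S.card ≤ a := by
    have : S.card ≤ (Finset.range a).card := Finset.card_le_card_of_injOn (fun i => (i : ℕ))
      (fun i hi => by simpa [S] using hi) fun i _ j _ h => Fin.ext h
    simpa using this
  obtain ⟨D, hD, z, hz⟩ := exists_circuit_unprepare S
    (C.mat *ᵥ fun u => v ((bits n).symm u)) (by
      rintro x ⟨i, hi, hxi⟩
      have hia : a ≤ i := by simpa [S] using hi
      rw [hCψ]
      by_contra hne
      have := hvs _ hne i hia
      rw [Equiv.apply_symm_apply] at this
      simp only [Pi.add_apply, u, if_pos hia] at this
      apply hxi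
      revert this
      generalize x i = p
      generalize x₀ i = q
      revert p q
      decide)
  have := cnotCost_householder_of_unprepare (c := 0) (d := 1) hv (C := C ++ D) (a := z)
    (by rw [Circuit.append_mulVec, hz])
  refine this.trans ((add_le_add le_rfl (costH0_le n)).trans ?_)
  norm_cast
  rw [Circuit.cnotCount_append]
  have h2 : 2 ^ S.card ≤ 2 ^ a := Nat.pow_le_pow_right two_pos hS
  omega

/-- The reflection along a superposition of two basis states. -/
theorem cnotCost_householder_pair {v : Fin (2 ^ n) → ℂ} (hv : star v ⬝ᵥ v = 1)
    {x y : Fin (2 ^ n)} (hxy : x ≠ y) (hvs : ∀ z, v z ≠ 0 → z = x ∨ z = y) :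
    cnotCost 0 1 (householder v) ≤ (84 * n : ℕ) := by
  have hbits : bits n x ≠ bits n y := fun h => hxy ((bits n).injective h)
  obtain ⟨k, hk⟩ := Function.ne_iff.mp hbits
  -- After the flips by the bits of `x`, the two states are zero and the mask of differing bits.
  -- Fanning out from `k` to `J` leaves a state of the single qubit `k`, which needs no further
  -- C-NOT.
  let J : Finset (Fin n) := Finset.univ.filter fun i => i ≠ k ∧ bits n x i ≠ bits n y i
  have hkJ : k ∉ J := by simp [J]
  have hJ : J.card ≤ n := by simpa using Finset.card_le_univ J
  obtain ⟨C, hC, hCψ⟩ := (hasPull_add (bits n x)).comp (hasPull_fanout k J hkJ)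
  obtain ⟨D, hD, z, hz⟩ := exists_circuit_unprepare {k}
    (C.mat *ᵥ fun u => v ((bits n).symm u)) (by
      rintro s ⟨i, hi, hsi⟩
      rw [Finset.mem_singleton] at hi
      rw [hCψ]
      by_contra hne
      apply hsi
      have h1 : ∀ p q : Fin 2, p + q = q → p = 0 := by decide
      have h2 : ∀ p q r : Fin 2, q ≠ r → p + q = r → p = 1 := by decide
      have h3 : ∀ p q r : Fin 2, q ≠ r → p + 1 + q = r → p = 0 := by decide
      rcases hvs _ hne with h | h
      all_goals
        rw [Equiv.symm_apply_eq] at h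
        have hsk := congrFun h k
        have hsi := congrFun h i
        simp only [Function.comp_apply, Pi.add_apply, if_neg hkJ] at hsk hsi
      · have hsk0 := h1 _ _ hsk
        rw [hsk0] at hsi
        simpa using h1 _ _ hsi
      · have hsk1 := h2 _ _ _ hk hsk
        rw [hsk1] at hsi
        by_cases hij : bits n x i = bits n y i
        · rw [if_neg (by simp [J, hij]), hij] at hsi
          exact h1 _ _ hsi
        · rw [if_pos (by simp [J, hij, hi])] at hsi
          exact h3 _ _ _ hij hsi)
  have := cnotCost_householder_of_unprepare (c := 0) (d := 1) hv (C := C ++ D) (a := z)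
    (by rw [Circuit.append_mulVec, hz])
  refine this.trans ((add_le_add le_rfl (costH0_le n)).trans ?_)
  norm_cast
  rw [Circuit.cnotCount_append]
  have hn : 0 < n := k.pos
  rw [Finset.card_singleton] at hD
  omega

end ReflectionCost

/-! ### Permutations and diagonal gates from two-level gates. -/

section TwoLevel

variable {n m : ℕ}

/-- The gate that exchanges two basis states with opposite phases. -/
theorem exists_phased_swap {x y : Fin (2 ^ n)} (hxy : x ≠ y) (ζ : Circle) :
    ∃ R : Matrix (Fin (2 ^ n)) (Fin (2 ^ n)) ℂ, cnotCost 0 1 R ≤ (84 * n : ℕ) ∧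
      ∀ φ z, (R *ᵥ φ) z = if z = x then ((ζ⁻¹ : Circle) : ℂ) * φ y else
        if z = y then (ζ : ℂ) * φ x else φ z := by
  obtain ⟨s, hs, hs'⟩ := hadamard_aux
  have hs'' : (starRingEnd ℂ) s = s := hs'
  have hζ : (ζ : ℂ)⁻¹ * ζ = 1 := inv_mul_cancel₀ ζ.coe_ne_zero
  -- With `s ^ 2 = 1 / 2`, the reflection along this unit vector exchanges `|x⟩` and `ζ|y⟩`.
  set v : Fin (2 ^ n) → ℂ := s • (Pi.single x 1 - (ζ : ℂ) • Pi.single y 1) with hv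
  have hdot : ∀ φ : Fin (2 ^ n) → ℂ, star v ⬝ᵥ φ = s * (φ x - (ζ : ℂ)⁻¹ * φ y) := by
    intro φ
    rw [hv, star_smul, star_sub, star_smul, smul_dotProduct, sub_dotProduct, smul_dotProduct,
      hs']
    simp [← Circle.coe_inv_eq_conj, Pi.star_single]
  have hunit : star v ⬝ᵥ v = 1 := by
    rw [hdot]
    simp only [hv, Pi.smul_apply, Pi.sub_apply, Pi.single_eq_same, Pi.single_eq_of_ne hxy,
      Pi.single_eq_of_ne hxy.symm, smul_eq_mul]
    linear_combination 2 * hs + s * s * hζ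
  refine ⟨householder v, cnotCost_householder_pair hunit hxy fun z hz => ?_, fun φ z => ?_⟩
  · by_contra hcon
    push Not at hcon
    apply hz
    simp [hv, hcon.1, hcon.2]
  · rw [householder_mulVec, hdot]
    simp only [hv, Pi.smul_apply, Pi.sub_apply, smul_eq_mul, Circle.coe_inv]
    by_cases hzx : z = x
    · subst hzx
      simp only [if_true, Pi.single_eq_same, Pi.single_eq_of_ne hxy]
      linear_combination (-2 * (φ z - (ζ : ℂ)⁻¹ * φ y)) * hs
    · by_cases hzy : z = y
      · subst hzy
        simp only [if_neg hzx, if_true, Pi.single_eq_same, Pi.single_eq_of_ne hzx]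
        linear_combination (2 * ((ζ : ℂ) * φ x - φ z)) * hs - 2 * s * s * φ z * hζ
      · simp [hzx, hzy]

theorem cnotCost_swap_le {x y : Fin (2 ^ n)} (hxy : x ≠ y) :
    cnotCost 0 1 ((Equiv.swap x y).permMatrix ℂ) ≤ (84 * n : ℕ) := by
  obtain ⟨R, hR, hRφ⟩ := exists_phased_swap hxy 1
  convert hR using 2
  apply Matrix.ext_of_mulVec_single
  intro k
  funext z
  rw [permMatrix_mulVec, hRφ, Function.comp_apply, Equiv.swap_apply_def]
  split_ifs <;> simp

/-- One transposition per step makes the highest moved point fixed. -/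
theorem cnotCost_perm_le (k : ℕ) (π : Equiv.Perm (Fin (2 ^ n)))
    (hπ : ∀ x : Fin (2 ^ n), k ≤ x → π x = x) :
    cnotCost 0 1 (π.permMatrix ℂ) ≤ (k * (84 * n) : ℕ) := by
  induction k generalizing π with
  | zero =>
    have : π = 1 := Equiv.ext fun x => hπ x (Nat.zero_le _)
    rw [this, permMatrix_one, cnotCost_one]
    exact zero_le
  | succ k ih =>
    have hmono : ((k * (84 * n) : ℕ) : ℕ∞) ≤ ((k + 1) * (84 * n) : ℕ) := by
      exact_mod_cast Nat.mul_le_mul_right _ (Nat.le_succ k)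
    by_cases hk : ∀ x : Fin (2 ^ n), k ≤ x → π x = x
    · exact (ih π hk).trans hmono
    · push Not at hk
      obtain ⟨κ, hκ, hne⟩ := hk
      have hκ' : (κ : ℕ) = k := by
        by_contra h
        exact hne (hπ κ (by omega))
      have hfix := ih (Equiv.swap κ (π κ) * π) fun x hx => by
        rw [Equiv.Perm.mul_apply]
        by_cases hxκ : x = κ
        · subst hxκ
          rw [Equiv.swap_apply_right]
        · have hx' : π x = x := hπ x (by
            have : (x : ℕ) ≠ κ := fun h => hxκ (Fin.ext h)
            omega)
          rw [hx', Equiv.swap_apply_of_ne_of_ne hxκ]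
          intro h
          rw [← hx'] at h
          exact hxκ (π.injective h)
      have hprod : π.permMatrix ℂ = (Equiv.swap κ (π κ) * π).permMatrix ℂ *
          (Equiv.swap κ (π κ)).permMatrix ℂ := by
        rw [← permMatrix_mul, ← mul_assoc, Equiv.swap_mul_self, one_mul]
      rw [hprod]
      refine (cnotCost_mul_le le_rfl _ _).trans ((add_le_add hfix
        (cnotCost_swap_le (Ne.symm hne))).trans ?_)
      norm_cast
      exact le_of_eq (by ring)

theorem costPermUpToDiag_le (n : ℕ) : costPermUpToDiag 0 1 n ≤ (2 ^ n * (84 * n) : ℕ) := by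
  refine iSup_le fun π => (iInf_le _ 1).trans ?_
  rw [diagGate_one, Matrix.one_mul]
  exact cnotCost_perm_le _ π fun x hx => absurd x.isLt (by omega)

/-- A phased swap followed or preceded by a plain one is diagonal with opposite phases. -/
theorem cnotCost_diag_pair_le {x y : Fin (2 ^ n)} (hxy : x ≠ y) (ζ : Circle) :
    cnotCost 0 1 (diagGate fun z => if z = x then ζ⁻¹ else if z = y then ζ else 1) ≤
      (168 * n : ℕ) := by
  obtain ⟨R, hR, hRφ⟩ := exists_phased_swap hxy ζ
  obtain ⟨R', hR', hRφ'⟩ := exists_phased_swap hxy 1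
  have : (diagGate fun z => if z = x then ζ⁻¹ else if z = y then ζ else 1) = R * R' := by
    apply Matrix.ext_of_mulVec_single
    intro k
    generalize (Pi.single k 1 : Fin (2 ^ n) → ℂ) = φ
    funext z
    rw [← Matrix.mulVec_mulVec, hRφ, hRφ', hRφ', hRφ', diagGate, Matrix.mulVec_diagonal]
    by_cases h1 : z = x
    · simp [h1, hxy.symm]
    · by_cases h2 : z = y
      · simp [h2, hxy.symm]
      · simp [h1, h2]
  rw [this]
  refine (cnotCost_mul_le le_rfl _ _).trans ((add_le_add hR hR').trans ?_)
  norm_cast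
  exact le_of_eq (by ring)

/-- Two-level gates push the phases one by one onto entry `0`. They preserve the product, so the
phase that ends up there is trivial. -/
theorem cnotCost_diag_le_of_prod_eq_one (k : ℕ) (z : Fin (2 ^ n) → Circle) (hz : ∏ x, z x = 1)
    (hk : ∀ x : Fin (2 ^ n), k < x → z x = 1) :
    cnotCost 0 1 (diagGate z) ≤ (k * (168 * n) : ℕ) := by
  induction k generalizing z with
  | zero =>
    have h0 : ∀ x, x ≠ 0 → z x = 1 := fun x hx =>
      hk x (Nat.pos_of_ne_zero fun h => hx (Fin.ext h))
    have : z = 1 := by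
      funext x
      by_cases hx : x = 0
      · subst hx
        rwa [Fintype.prod_eq_single 0 h0] at hz
      · exact h0 x hx
    rw [this, diagGate_one, cnotCost_one]
    exact zero_le
  | succ k ih =>
    have hmono : ((k * (168 * n) : ℕ) : ℕ∞) ≤ ((k + 1) * (168 * n) : ℕ) := by
      exact_mod_cast Nat.mul_le_mul_right _ (Nat.le_succ k)
    by_cases hkn : k + 1 < 2 ^ n
    · let κ : Fin (2 ^ n) := ⟨k + 1, hkn⟩
      have hκ : (0 : Fin (2 ^ n)) ≠ κ := fun h => absurd (congrArg Fin.val h) (by simp [κ])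
      let w : Fin (2 ^ n) → Circle := fun x =>
        if x = 0 then (z κ)⁻¹ else if x = κ then z κ else 1
      have hw : ∏ x, w x = 1 := by
        rw [Fintype.prod_eq_mul 0 κ hκ fun x hx => by simp [w, hx.1, hx.2]]
        simp [w, hκ.symm]
      have hprod := ih (w⁻¹ * z) (by simp [Finset.prod_mul_distrib, hz, hw]) fun x hx => by
        have hx0 : x ≠ 0 := fun h => by
          rw [h] at hx
          exact absurd hx (by simp)
        by_cases hxκ : x = κ
        · simp [w, hxκ, hκ.symm]
        · have : (x : ℕ) ≠ k + 1 := fun h => hxκ (Fin.ext h)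
          simp [w, hx0, hxκ, hk x (by omega)]
      have : diagGate z = diagGate w * diagGate (w⁻¹ * z) := by
        rw [diagGate_mul, mul_inv_cancel_left]
      rw [this]
      refine (cnotCost_mul_le le_rfl _ _).trans ((add_le_add
        (cnotCost_diag_pair_le hκ (z κ)) hprod).trans ?_)
      norm_cast
      exact le_of_eq (by ring)
    · exact (ih z hz fun x hx => absurd x.isLt (by omega)).trans hmono

theorem cnotCost_diag_const (c d : ℕ) (a : Circle) :
    cnotCost c d (diagGate fun _ : Fin (2 ^ n) => a) = 0 := by
  have h := cnotCost_dataMat_le (c := c) (d := d) [(Gate.phase a : Gate (Fin n))]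
  have : Circuit.dataMat [(Gate.phase a : Gate (Fin n))] = diagGate fun _ => a := by
    apply Matrix.ext_of_mulVec_single
    intro y
    funext x
    rw [Circuit.dataMat_mulVec, Circuit.singleton_mulVec, Gate.phase_mulVec, diagGate,
      Matrix.mulVec_diagonal]
    simp
  rw [this] at h
  simpa [Circuit.cnotCount, Gate.isCnot] using h

theorem Circle.exists_pow_eq (a : Circle) {N : ℕ} (hN : N ≠ 0) : ∃ b : Circle, b ^ N = a := by
  refine ⟨Circle.exp (Complex.arg a / N), ?_⟩
  rw [← Circle.exp_nsmul, nsmul_eq_mul, mul_div_cancel₀ _ (by exact_mod_cast hN), Circle.exp_arg]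

/-- A `2 ^ n`-th root of the product of the entries is split off as a free global phase, which makes
the remaining product one. -/
theorem costDiag_le (n : ℕ) : costDiag 0 1 n ≤ (2 ^ n * (168 * n) : ℕ) := by
  refine iSup_le fun z => ?_
  obtain ⟨a, ha⟩ := Circle.exists_pow_eq (∏ x, z x) (pow_ne_zero n two_ne_zero)
  have : diagGate z = (diagGate fun _ => a) * diagGate ((fun _ => a⁻¹) * z) := by
    rw [diagGate_mul]
    congr 1
    funext x
    simp
  rw [this]
  refine (cnotCost_mul_le le_rfl _ _).trans ?_
  rw [cnotCost_diag_const, zero_add]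
  refine cnotCost_diag_le_of_prod_eq_one _ _ ?_ fun x hx => absurd x.isLt (by omega)
  simp [Finset.prod_mul_distrib, ← ha]

end TwoLevel

/-! ### The second bound: clearing a column through dyadic blocks. -/

section Columns

variable {n m : ℕ}

theorem two_pow_clog_le {l : ℕ} (hl : 1 ≤ l) : 2 ^ Nat.clog 2 l ≤ 2 * (l - 1) + 1 := by
  rcases hl.eq_or_lt with rfl | hl
  · simp
  · have h1 := Nat.pow_pred_clog_lt_self one_lt_two hl
    have h2 : 0 < Nat.clog 2 l := Nat.clog_pos one_lt_two hl
    obtain ⟨c, hc⟩ := Nat.exists_eq_succ_of_ne_zero h2.ne'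
    rw [hc, Nat.pred_succ] at h1
    rw [hc, pow_succ]
    omega

theorem div_two_pow_eq_of_le {x y a k : ℕ} (h : x / 2 ^ a = y / 2 ^ a) (hk : a ≤ k) :
    x / 2 ^ k = y / 2 ^ k := by
  obtain ⟨l, rfl⟩ := Nat.exists_eq_add_of_le hk
  rw [pow_add, ← Nat.div_div_eq_div_mul, ← Nat.div_div_eq_div_mul, h]

/-- An interval is the union of two intervals that are contained in dyadic blocks of comparable
lengths. -/
theorem exists_dyadic_split (t i e : ℕ) (hie : i < e) (ht : i / 2 ^ t = e / 2 ^ t) :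
    ∃ M a b, i < M ∧ M ≤ e ∧ (∀ x, i ≤ x → x < M → x / 2 ^ a = i / 2 ^ a) ∧
      2 ^ a ≤ 2 * (M - 1 - i) + 1 ∧ (∀ x, M ≤ x → x ≤ e → x / 2 ^ b = M / 2 ^ b) ∧
      2 ^ b ≤ 2 * (e - M) + 1 := by
  induction t with
  | zero => simp at ht; omega
  | succ t ih =>
    -- Descend to the smallest common block. Its two halves then separate `i` from `e`, and the cut
    -- is made at their boundary.
    by_cases h : i / 2 ^ t = e / 2 ^ t
    · exact ih h
    have hpos : 0 < 2 ^ t := by positivity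
    rw [pow_succ, ← Nat.div_div_eq_div_mul, ← Nat.div_div_eq_div_mul] at ht
    have hle : i / 2 ^ t ≤ e / 2 ^ t := Nat.div_le_div_right hie.le
    obtain ⟨p, hp⟩ : ∃ p, i / 2 ^ t = p := ⟨_, rfl⟩
    have hp' : e / 2 ^ t = p + 1 := by omega
    have hi1 : p * 2 ^ t ≤ i := by rw [← hp]; exact Nat.div_mul_le_self _ _
    have hi2 : i < (p + 1) * 2 ^ t := by
      rw [← hp, Nat.add_mul, one_mul]; exact Nat.lt_div_mul_add hpos
    have he1 : (p + 1) * 2 ^ t ≤ e := by rw [← hp']; exact Nat.div_mul_le_self _ _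
    have he2 : e < (p + 1 + 1) * 2 ^ t := by
      rw [← hp', Nat.add_mul, one_mul]; exact Nat.lt_div_mul_add hpos
    rw [Nat.add_mul, one_mul] at hi2 he1
    rw [Nat.add_mul, Nat.add_mul, one_mul] at he2
    have hdvd : ∀ a ≤ t, ∃ q, (p + 1) * 2 ^ t = q * 2 ^ a := fun a ha => by
      obtain ⟨l, rfl⟩ := Nat.exists_eq_add_of_le ha
      exact ⟨(p + 1) * 2 ^ l, by ring⟩
    have hMe : (p + 1) * 2 ^ t = p * 2 ^ t + 2 ^ t := by ring
    -- The lengths are rounded up to powers of two. These divide the cut point, so each interval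
    -- lies in one aligned block ending or starting there.
    refine ⟨(p + 1) * 2 ^ t, Nat.clog 2 ((p + 1) * 2 ^ t - i), Nat.clog 2 (e - (p + 1) * 2 ^ t + 1),
      by omega, by omega, fun x hx1 hx2 => ?_, ?_, fun x hx1 hx2 => ?_, ?_⟩
    · obtain ⟨q, hq⟩ := hdvd _ (Nat.clog_le_of_le_pow
        (show (p + 1) * 2 ^ t - i ≤ 2 ^ t by omega))
      have hL := Nat.le_pow_clog one_lt_two ((p + 1) * 2 ^ t - i)
      generalize Nat.clog 2 ((p + 1) * 2 ^ t - i) = a at *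
      have hq0 : q ≠ 0 := by
        rintro rfl
        omega
      obtain ⟨r, rfl⟩ := Nat.exists_eq_succ_of_ne_zero hq0
      have key : ∀ y, i ≤ y → y < (p + 1) * 2 ^ t → y / 2 ^ a = r := fun y h1 h2 => by
        have hexp : (r + 1) * 2 ^ a = r * 2 ^ a + 2 ^ a := by ring
        rw [Nat.succ_eq_add_one] at hq
        refine Nat.div_eq_of_lt_le ?_ ?_ <;> omega
      rw [key x hx1 hx2, key i le_rfl (by omega)]
    · have := two_pow_clog_le (show 1 ≤ (p + 1) * 2 ^ t - i by omega)
      omega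
    · obtain ⟨q, hq⟩ := hdvd _ (Nat.clog_le_of_le_pow
        (show e - (p + 1) * 2 ^ t + 1 ≤ 2 ^ t by omega))
      have hL := Nat.le_pow_clog one_lt_two (e - (p + 1) * 2 ^ t + 1)
      generalize Nat.clog 2 (e - (p + 1) * 2 ^ t + 1) = b at *
      have key : ∀ y, (p + 1) * 2 ^ t ≤ y → y ≤ e → y / 2 ^ b = q := fun y h1 h2 => by
        have hexp : (q + 1) * 2 ^ b = q * 2 ^ b + 2 ^ b := by ring
        refine Nat.div_eq_of_lt_le ?_ ?_ <;> omega
      rw [key x hx1 hx2, key _ le_rfl (by omega)]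
    · have := two_pow_clog_le (show 1 ≤ e - (p + 1) * 2 ^ t + 1 by omega)
      omega

/-- A reflection supported on an interval in a dyadic block clears it except for one row. -/
theorem exists_block_clearing {l u a : ℕ} {i : Fin (2 ^ n)} (hi : l ≤ i ∧ (i : ℕ) ≤ u)
    (hblock : ∀ x, l ≤ x → x ≤ u → x / 2 ^ a = i / 2 ^ a) (w : Fin (2 ^ n) → ℂ) :
    ∃ A : Matrix (Fin (2 ^ n)) (Fin (2 ^ n)) ℂ, Aᴴ * A = 1 ∧
      ActsOn {x | l ≤ (x : ℕ) ∧ (x : ℕ) ≤ u} A ∧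
      (∀ x : Fin (2 ^ n), l ≤ x → x ≤ u → x ≠ i → (A *ᵥ w) x = 0) ∧
      cnotCost 0 1 A ≤ (2 * (2 ^ a - 1) + 80 * n : ℕ) := by
  obtain ⟨v, hv, hvS, hvw⟩ :=
    exists_clearing_householder {x : Fin (2 ^ n) | l ≤ (x : ℕ) ∧ (x : ℕ) ≤ u} hi w
  refine ⟨householder v, householder_isometry hv, actsOn_householder hvS,
    fun x h1 h2 => hvw x ⟨h1, h2⟩, cnotCost_householder_block hv (bits n i) fun x hx k hk => ?_⟩
  have hxS : l ≤ (x : ℕ) ∧ (x : ℕ) ≤ u := by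
    by_contra h
    exact hx (hvS x h)
  apply Fin.ext
  rw [bits_val, bits_val, div_two_pow_eq_of_le (hblock x hxS.1 hxS.2) hk]

/-- Two block reflections leave only the rows `i` and `M`, and a two-level reflection merges these.
The overheads `80 + 80 + 84` give `244`. -/
theorem exists_column_clearing {i : Fin (2 ^ n)} {e : ℕ} (hie : (i : ℕ) ≤ e) (hen : e < 2 ^ n)
    (w : Fin (2 ^ n) → ℂ) :
    ∃ A : Matrix (Fin (2 ^ n)) (Fin (2 ^ n)) ℂ, Aᴴ * A = 1 ∧
      ActsOn {x | (i : ℕ) ≤ x ∧ (x : ℕ) ≤ e} A ∧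
      (∀ x : Fin (2 ^ n), (i : ℕ) ≤ x → (x : ℕ) ≤ e → x ≠ i → (A *ᵥ w) x = 0) ∧
      cnotCost 0 1 A ≤ (4 * (e - i) + 244 * n : ℕ) := by
  rcases hie.eq_or_lt with hie' | hie'
  · refine ⟨1, by simp, actsOn_one _, fun x h1 h2 hx => absurd (Fin.ext (by omega)) hx, ?_⟩
    rw [cnotCost_one]
    exact zero_le
  obtain ⟨M, a, b, hiM, hMe, hblock₁, ha, hblock₂, hb⟩ := exists_dyadic_split n i e hie'
    (by rw [Nat.div_eq_of_lt i.isLt, Nat.div_eq_of_lt hen])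
  let M' : Fin (2 ^ n) := ⟨M, by omega⟩
  obtain ⟨A₁, hA₁, hS₁, hw₁, hc₁⟩ := exists_block_clearing (i := M') (l := M) (u := e)
    ⟨le_rfl, hMe⟩ hblock₂ w
  obtain ⟨A₂, hA₂, hS₂, hw₂, hc₂⟩ := exists_block_clearing (i := i) (l := i) (u := M - 1)
    ⟨le_rfl, by omega⟩ (fun x h1 h2 => hblock₁ x h1 (by omega)) (A₁ *ᵥ w)
  obtain ⟨v, hv, hvS, hvw⟩ := exists_clearing_householder ({i, M'} : Set (Fin (2 ^ n)))
    (i := i) (by simp) (A₂ *ᵥ (A₁ *ᵥ w))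
  have hiM' : i ≠ M' := fun h => absurd (congrArg Fin.val h) (by simp only [M']; omega)
  have hc₃ : cnotCost 0 1 (householder v) ≤ (84 * n : ℕ) :=
    cnotCost_householder_pair hv hiM' fun z hz => by
      by_contra h
      exact hz (hvS z h)
  have hS₃ := actsOn_householder hvS
  refine ⟨householder v * (A₂ * A₁), isometry_mul (householder_isometry hv)
    (isometry_mul hA₂ hA₁), ?_, fun x h1 h2 hx => ?_, ?_⟩
  · refine (hS₃.mono ?_).mul ((hS₂.mono ?_).mul (hS₁.mono ?_))
    · rintro x (rfl | rfl)
      · exact ⟨le_rfl, hie⟩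
      · exact ⟨hiM.le, hMe⟩
    · exact fun x hx => ⟨hx.1, hx.2.trans (by omega)⟩
    · exact fun x hx => ⟨hiM.le.trans hx.1, hx.2⟩
  · rw [← Matrix.mulVec_mulVec, ← Matrix.mulVec_mulVec]
    by_cases hxM : x = M'
    · exact hvw x (by simp [hxM]) hx
    · rw [hS₃.1 _ x (by simp [hx, hxM])]
      rcases Nat.lt_or_ge (x : ℕ) M with h | h
      · exact hw₂ x h1 (by omega) hx
      · rw [hS₂.1 _ x fun hmem => by
          have : (x : ℕ) ≤ M - 1 := hmem.2
          omega]
        exact hw₁ x h h2 hxM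
  · refine (cnotCost_mul_le le_rfl _ _).trans ((add_le_add hc₃
      ((cnotCost_mul_le le_rfl _ _).trans (add_le_add hc₂ hc₁))).trans ?_)
    norm_cast
    omega

/-- The reduction meets a nonempty band in every column; the free predicate `Q` is used here just to
record this. -/
theorem le_env {W : Matrix (Fin (2 ^ n)) (Fin (2 ^ m)) ℂ} (hW : IsIsometry W) (j : Fin (2 ^ m)) :
    (j : ℕ) ≤ env W j := by
  have h := isLeast_env W
  obtain ⟨-, hQ, -⟩ := exists_reduction hW h.1.1 h.1.2
    (fun i _ => ∀ j : Fin (2 ^ m), (j : ℕ) < i → (j : ℕ) ≤ env W j) (by simp)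
    (fun i i' hi' hie w hw B hB => by
      obtain ⟨v, hv, hvS, hvw⟩ := exists_clearing_householder
        (band (env W) i) (i := i') ⟨hi'.ge, hi'.trans_le hie⟩ w
      refine ⟨householder v, householder_isometry hv, actsOn_householder hvS, fun x hx => ?_,
        fun j hj => ?_⟩
      · by_cases hxS : x ∈ (band (env W) i : Set (Fin (2 ^ n)))
        · exact hvw x hxS hx
        · rw [(actsOn_householder hvS).1 w x hxS, hw x hxS]
      · rcases Nat.lt_succ_iff_lt_or_eq.mp hj with h | h
        · exact hB j h
        · rwa [Fin.ext h])
  exact hQ j j.isLt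

theorem cnotCost_le_ed {W : Matrix (Fin (2 ^ n)) (Fin (2 ^ m)) ℂ} (hW : IsIsometry W)
    (ρ : Equiv.Perm (Fin (2 ^ n))) (σ : Equiv.Perm (Fin (2 ^ m))) :
    cnotCost 0 1 W ≤ costPermUpToDiag 0 1 n
      + (∑ i : Fin (2 ^ m), (4 * (env (permuted ρ σ W) i - i) + 244 * n) : ℕ)
      + costPermUpToDiag 0 1 m + costDiag 0 1 m := by
  refine cnotCost_le_of_reduction hW ρ σ _ fun W' hW' hzero => ?_
  set e := env (permuted ρ σ W) with he
  have hmono : Monotone e := (isLeast_env (permuted ρ σ W)).1.1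
  have hspec : ∀ (j : Fin (2 ^ m)) (x : Fin (2 ^ n)), e j < x → permuted ρ σ W x j = 0 :=
    (isLeast_env (permuted ρ σ W)).1.2
  let t : ℕ → ℕ := fun i => if h : i < 2 ^ m then 4 * (e ⟨i, h⟩ - i) + 244 * n else 0
  suffices h : ∃ B : Matrix (Fin (2 ^ n)) (Fin (2 ^ n)) ℂ, cnotCost 0 1 B ≤ (∑ j ∈ Finset.range (2 ^ m), t j : ℕ) ∧
      Bᴴ * B = 1 ∧ ∃ z : Fin (2 ^ m) → Circle, B * W' = incl n m * diagGate z by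
    obtain ⟨B, hB, hBi, z, hz⟩ := h
    refine ⟨B, 1, hBi, hB.trans (le_of_eq ?_), cnotCost_one, z, by rw [hz, Matrix.one_mul]⟩
    rw [← Fin.sum_univ_eq_sum_range]
    congr 1
    refine Finset.sum_congr rfl fun i _ => ?_
    simp [t]
  refine exists_reduction hW' hmono (fun j x hx => hzero x j (hspec j x hx))
    (fun i B => cnotCost 0 1 B ≤ (∑ j ∈ Finset.range i, t j : ℕ))
    (by simp [cnotCost_one]) fun i i' hi' hie w hw B hB => ?_
  have hen : e i < 2 ^ n := by
    have : e i ≤ 2 ^ n - 1 := Nat.sInf_le fun k _ x hx => absurd x.isLt (by omega)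
    have hpos : 0 < 2 ^ n := by positivity
    omega
  obtain ⟨A, hA, hAS, hAw, hAc⟩ := exists_column_clearing (i := i') (hi'.trans_le hie) hen w
  rw [hi'] at hAS hAw hAc
  refine ⟨A, hA, hAS, fun x hx => ?_, ?_⟩
  · by_cases hxS : x ∈ (band e i : Set (Fin (2 ^ n)))
    · exact hAw x hxS.1 hxS.2 hx
    · rw [hAS.1 w x hxS, hw x hxS]
  · refine (cnotCost_mul_le le_rfl _ _).trans ((add_le_add hAc hB).trans ?_)
    rw [Finset.sum_range_succ, show t i = 4 * (e i - i) + 244 * n by simp [t]]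
    norm_cast
    omega

/-- Here `580 = 84 + 84 + 168 + 244`: row permutation, column permutation, diagonal gate and column
overhead, with `m ≤ n`. By `le_env` the truncated subtractions agree with the integer ones in `ed`.
-/
theorem exists_circuit_le_ed {W : Matrix (Fin (2 ^ n)) (Fin (2 ^ m)) ℂ} (hW : IsIsometry W)
    (ρ : Equiv.Perm (Fin (2 ^ n))) (σ : Equiv.Perm (Fin (2 ^ m))) :
    ∃ C : Circuit (Register n 0 1), Implements 0 1 C W ∧
      (C.cnotCount : ℤ) ≤ 4 * ed (permuted ρ σ W) + (580 : ℕ) * ((n : ℤ) * 2 ^ n) := by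
  have hmn := le_of_isIsometry hW
  have h := (cnotCost_le_ed hW ρ σ).trans (add_le_add (add_le_add (add_le_add
    (costPermUpToDiag_le n) le_rfl) (costPermUpToDiag_le m)) (costDiag_le m))
  norm_cast at h
  have htop : cnotCost 0 1 W ≠ ⊤ := ne_top_of_le_ne_top (ENat.natCast_ne_top _) h
  obtain ⟨C, hC, hCc⟩ := exists_circuit_of_cnotCost_ne_top htop
  refine ⟨C, hC, ?_⟩
  rw [← hCc] at h
  have h' : C.cnotCount ≤ 2 ^ n * (84 * n) +
      ∑ i : Fin (2 ^ m), (4 * (env (permuted ρ σ W) i - i) + 244 * n) +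
      2 ^ m * (84 * m) + 2 ^ m * (168 * m) := by exact_mod_cast h
  have hed : ((∑ i : Fin (2 ^ m), (4 * (env (permuted ρ σ W) i - i) + 244 * n) : ℕ) : ℤ) =
      4 * ed (permuted ρ σ W) + 2 ^ m * (244 * n) := by
    rw [ed, Finset.mul_sum]
    push_cast
    rw [Finset.sum_add_distrib]
    congr 1
    · refine Finset.sum_congr rfl fun i _ => ?_
      rw [Nat.cast_sub (le_env (permuted_isometry hW ρ σ) i)]
    · simp
  have hpow : 2 ^ m ≤ 2 ^ n := Nat.pow_le_pow_right two_pos hmn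
  have h1 : 2 ^ m * (84 * m) ≤ 2 ^ n * (84 * n) := by gcongr
  have h2 : 2 ^ m * (168 * m) ≤ 2 ^ n * (168 * n) := by gcongr
  have h3 : 2 ^ m * (244 * n) ≤ 2 ^ n * (244 * n) := by gcongr
  zify at h' h1 h2 h3
  push_cast at hed
  rw [hed] at h'
  push_cast
  linarith

end Columns

end SparseIso

theorem mainTheorem5 :
    (∀ (n m c d : ℕ) (W : Matrix (Fin (2 ^ n)) (Fin (2 ^ m)) ℂ), SparseIso.IsIsometry W →
      ∀ (ρ : Equiv.Perm (Fin (2 ^ n))) (σ : Equiv.Perm (Fin (2 ^ m))),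
        SparseIso.cnotCost c d W ≤
          SparseIso.costPermUpToDiag c d n
            + ∑ i : Fin (2 ^ m),
                SparseIso.costCol c d n (SparseIso.logHeight (SparseIso.permuted ρ σ W) i)
            + SparseIso.costPermUpToDiag c d m
            + SparseIso.costDiag c d m) ∧
    (∃ K : ℕ, ∀ (n m : ℕ) (W : Matrix (Fin (2 ^ n)) (Fin (2 ^ m)) ℂ), SparseIso.IsIsometry W →
      ∀ (ρ : Equiv.Perm (Fin (2 ^ n))) (σ : Equiv.Perm (Fin (2 ^ m))),
        ∃ C : SparseIso.Circuit (SparseIso.Register n 0 1),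
          SparseIso.Implements 0 1 C W ∧
            (C.cnotCount : ℤ) ≤
              4 * SparseIso.ed (SparseIso.permuted ρ σ W) + (K : ℤ) * ((n : ℤ) * 2 ^ n)) :=
  ⟨fun _ _ _ _ _ hW ρ σ => SparseIso.costCol_reduction hW ρ σ,
    580, fun _ _ _ hW ρ σ => SparseIso.exists_circuit_le_ed hW ρ σ⟩

end
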